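/- **Conventions.** For real numbers $\theta_0>\theta_1>\theta_2$, let $\mathscr G_3(\theta_0,\theta_1,\theta_2)$ be the set of connected finite simple graphs whose adjacency matrix has exactly the three distinct eigenvalues $\theta_0,\theta_1,\theta_2$. The *coherent closure* of a graph $\Gamma$ is the smallest coherent algebra containing its adjacency matrix, where a coherent algebra is a complex matrix algebra (indexed by the vertices) that contains the identity matrix $I$ and the all-ones matrix $J$ and is closed under transposition and the entrywise product. The *coherent rank* of $\Gamma$ is the rank of its coherent closure, that is, the size of its unique basis of $\{0,1\}$-matrices $A_1,\dots,A_r$ with $\sum_i A_i=J$ (equivalently, its dimension). A *QSD* (quasi-symmetric design) $\mathcal Q$ with parameters $(v,k,\lambda;b,r,\{x,y\})$ is a family of $b$ blocks (repetitions allowed), each a $k$-subset of a $v$-set of points with $1\le k\le v$, such that every pair of distinct points is contained in exactly $\lambda$ blocks, every point is in exactly $r$ blocks, any two blocks of the family meet in either $x$ or $y$ points, both of these occur, and $x\neq y$. Let $M$ be its point-by-block incidence matrix. The *$x$-block graph* $\mathsf B_x(\mathcal Q)$ has the blocks as vertices, two distinct blocks being adjacent if they meet in exactly $x$ points. The *$x$-total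 graph* $\mathsf T_x(\mathcal Q)$ and the *$x$-whole graph* $\mathsf W_x(\mathcal Q)$ are the graphs with adjacency matrices $$\begin{bmatrix} O & M\\ M^\top & A(\mathsf B_x(\mathcal Q))\end{bmatrix}\quad\text{and}\quad \begin{bmatrix} J-I & M\\ M^\top & A(\mathsf B_x(\mathcal Q))\end{bmatrix}.$$ **Theorem 5.8.** Let $\theta_1\ge 1$ and $\theta_2\le -2$ be integers. Suppose that $\mathcal Q$ is a QSD with parameters $(v,k,\lambda;b,r,\{x,y\})$ where $\mathsf B_x(\mathcal Q)\in\mathscr G_3(e_0,e_1,e_2)$ and $$(x,y)=\bigl(k+(\theta_1+1)(\theta_2+1)-(e_1+1)(e_2+1),\ k+\theta_1\theta_2-e_1e_2\bigr).$$ (i) If $\lambda=r+\theta_1\theta_2$, $\ \dfrac{r-\lambda+y-k}{x-y}=\theta_1+\theta_2$, and $\ \dfrac{\lambda k-yr}{x-y}=\sqrt{\lambda(k+e_0+\theta_1\theta_2)}$, then $$\mathsf T_x(\mathcal Q)\in\mathscr G_3(e_0-\theta_2,\theta_1,\theta_2).$$ Furthermore, if $r\ne k+e_0$ then $\mathsf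 T_x(\mathcal Q)$ has coherent rank $9$. (ii) If $\lambda=r+(\theta_1+1)(\theta_2+1)$, $\ \dfrac{r-\lambda+y-k}{x-y}=\theta_1+\theta_2+1$, and $\ k+\dfrac{\lambda k-yr}{x-y}=\sqrt{(v-1+r+\theta_1\theta_2)(k+e_0+\theta_1\theta_2)}$, then $$\mathsf W_x(\mathcal Q)\in\mathscr G_3\left(\frac{v-1+e_0+\sqrt{(v-1-e_0)^2+4rk}}{2},\ \theta_1,\ \theta_2\right).$$ Furthermore, if $v-1+r\neq k+e_0$ then $\mathsf W_x(\mathcal Q)$ has coherent rank $9$. -/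

import Mathlib

open scoped Matrix

noncomputable section

/-! ### Graphs with three distinct eigenvalues -/

open Classical in
/-- `G` is connected and the set of eigenvalues of its adjacency matrix is exactly
`{t₀, t₁, t₂}`, where `t₀ > t₁ > t₂`; that is, `G` belongs to `𝒢₃(t₀, t₁, t₂)`. -/
def IsG3 {V : Type*} [Fintype V] (G : SimpleGraph V) (t₀ t₁ t₂ : ℝ) : Prop :=
  G.Connected ∧ t₂ < t₁ ∧ t₁ < t₀ ∧ spectrum ℝ (G.adjMatrix ℝ) = {t₀, t₁, t₂}

/-! ### Coherent rank -/

section Coherent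

open Classical

/-- A coherent algebra: a complex matrix algebra (a `Subalgebra`, so it contains the identity)
that contains the all-ones matrix and is closed under transposition and the entrywise product. -/
structure IsCoherentAlgebra {V : Type*} [Fintype V]
    (S : Subalgebra ℂ (Matrix V V ℂ)) : Prop where
  allOnes_mem : (Matrix.of fun _ _ => (1 : ℂ)) ∈ S
  transpose_mem : ∀ M ∈ S, Mᵀ ∈ S
  hadamard_mem : ∀ M ∈ S, ∀ N ∈ S, M ⊙ N ∈ S

/-- The coherent closure of `G`: the intersection of all coherent algebras that contain the
adjacency matrix of `G`. -/
def coherentClosure {V : Type*} [Fintype V] (G : SimpleGraph V) :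
    Subalgebra ℂ (Matrix V V ℂ) :=
  sInf {S | IsCoherentAlgebra S ∧ G.adjMatrix ℂ ∈ S}

/-- The coherent closure is itself a coherent algebra. -/
theorem coherentClosure_isCoherentAlgebra {V : Type*} [Fintype V] (G : SimpleGraph V) :
    IsCoherentAlgebra (coherentClosure G) where
  allOnes_mem := Algebra.mem_sInf.2 fun _ hS => hS.1.allOnes_mem
  transpose_mem M hM := Algebra.mem_sInf.2 fun S hS =>
    hS.1.transpose_mem M (Algebra.mem_sInf.1 hM S hS)
  hadamard_mem M hM N hN := Algebra.mem_sInf.2 fun S hS =>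
    hS.1.hadamard_mem M (Algebra.mem_sInf.1 hM S hS) N (Algebra.mem_sInf.1 hN S hS)

/-- The coherent closure contains the adjacency matrix. -/
theorem adjMatrix_mem_coherentClosure {V : Type*} [Fintype V] (G : SimpleGraph V) :
    G.adjMatrix ℂ ∈ coherentClosure G :=
  Algebra.mem_sInf.2 fun _ hS => hS.2

/-- The coherent closure is contained in every coherent algebra containing the adjacency
matrix. -/
theorem coherentClosure_le {V : Type*} [Fintype V] (G : SimpleGraph V)
    {S : Subalgebra ℂ (Matrix V V ℂ)} (hS : IsCoherentAlgebra S) (hG : G.adjMatrix ℂ ∈ S) :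
    coherentClosure G ≤ S :=
  sInf_le ⟨hS, hG⟩

/-- The coherent rank of `G`: the rank of its coherent closure. The `{0,1}`-matrices of the
relations of the associated coherent configuration form a vector space basis of the algebra, so
that the number of relations is the dimension of the algebra. -/
def coherentRank {V : Type*} [Fintype V] (G : SimpleGraph V) : ℕ :=
  Module.finrank ℂ (coherentClosure G)

end Coherent

/-! ### Designs

A design on the point set `P` is a family `blk : B → Finset P` of blocks, indexed by a finite
type `B`; repeated blocks are allowed. -/

open Classical in
/-- `blk` is a `t`-`(v, k, lam)` design. -/
structure IsTDesign {P B : Type*} [Fintype P] [Fintype B] (blk : B → Finset P)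
    (t v k lam : ℕ) : Prop where
  card_points : Fintype.card P = v
  one_le_k : 1 ≤ k
  k_le_v : k ≤ v
  card_block : ∀ i : B, (blk i).card = k
  card_blocks_superset : ∀ T : Finset P, T.card = t →
    (Finset.univ.filter fun i : B => T ⊆ blk i).card = lam

open Classical in
/-- `blk` is a quasi-symmetric `2`-design with parameters `(v, k, lam; b, r, {x, y})`: there are
`b` blocks, every point lies in `r` blocks, any two blocks (with different indices) meet in
`x` or in `y` points, both numbers occur, and `x ≠ y`. -/
structure IsQSD {P B : Type*} [Fintype P] [Fintype B] (blk : B → Finset P)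
    (v k lam b r x y : ℕ) : Prop where
  isDesign : IsTDesign blk 2 v k lam
  card_blocks : Fintype.card B = b
  card_blocks_through : ∀ p : P, (Finset.univ.filter fun i : B => p ∈ blk i).card = r
  card_inter : ∀ i j : B, i ≠ j → (blk i ∩ blk j).card = x ∨ (blk i ∩ blk j).card = y
  exists_inter_eq_x : ∃ i j : B, i ≠ j ∧ (blk i ∩ blk j).card = x
  exists_inter_eq_y : ∃ i j : B, i ≠ j ∧ (blk i ∩ blk j).card = y
  x_ne_y : x ≠ y

open Classical in
/-- The incidence matrix, with rows indexed by points and columns by blocks. -/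
def incidenceMatrix {P B : Type*} (R : Type*) [Zero R] [One R] (blk : B → Finset P) :
    Matrix P B R :=
  Matrix.of fun p i => if p ∈ blk i then 1 else 0

open Classical in
/-- The `x`-block graph `B_x`: distinct blocks are adjacent when they meet in `x` points. -/
def blockGraph {P B : Type*} (blk : B → Finset P) (x : ℕ) : SimpleGraph B where
  Adj i j := i ≠ j ∧ (blk i ∩ blk j).card = x
  symm := ⟨fun i j h => ⟨h.1.symm, by rw [Finset.inter_comm]; exact h.2⟩⟩
  loopless := ⟨fun _ h => h.1 rfl⟩

/-- The graph on the points and blocks that induces `H` on the points, induces the `x`-block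
graph on the blocks, and joins a point to the blocks containing it. -/
def pointBlockGraph {P B : Type*} (H : SimpleGraph P) (blk : B → Finset P) (x : ℕ) :
    SimpleGraph (P ⊕ B) where
  Adj u w :=
    match u, w with
    | Sum.inl p, Sum.inl q => H.Adj p q
    | Sum.inl p, Sum.inr i => p ∈ blk i
    | Sum.inr i, Sum.inl p => p ∈ blk i
    | Sum.inr i, Sum.inr j => (blockGraph blk x).Adj i j
  symm := ⟨by
    rintro (p | i) (q | j) h
    · exact H.symm.symm _ _ h
    · exact h
    · exact h
    · exact (blockGraph blk x).symm.symm _ _ h⟩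
  loopless := ⟨by
    rintro (p | i) h
    · exact H.loopless.irrefl _ h
    · exact (blockGraph blk x).loopless.irrefl _ h⟩

/-- The `x`-total graph `T_x`: no two points are adjacent. -/
def totalGraph {P B : Type*} (blk : B → Finset P) (x : ℕ) : SimpleGraph (P ⊕ B) :=
  pointBlockGraph ⊥ blk x

/-- The `x`-whole graph `W_x`: any two distinct points are adjacent. -/
def wholeGraph {P B : Type*} (blk : B → Finset P) (x : ℕ) : SimpleGraph (P ⊕ B) :=
  pointBlockGraph ⊤ blk x

open Classical in
/-- The adjacency matrix of `T_x` is `[[O, M], [Mᵀ, A(B_x)]]`, `M` the incidence matrix. -/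
theorem adjMatrix_totalGraph {P B : Type*} (R : Type*) [Zero R] [One R]
    (blk : B → Finset P) (x : ℕ) :
    (totalGraph blk x).adjMatrix R =
      Matrix.fromBlocks 0 (incidenceMatrix R blk) (incidenceMatrix R blk)ᵀ
        ((blockGraph blk x).adjMatrix R) := by
  ext (p | i) (q | j) <;>
    simp [totalGraph, pointBlockGraph, incidenceMatrix, SimpleGraph.adjMatrix_apply]

open Classical in
/-- The adjacency matrix of `W_x` is `[[J - I, M], [Mᵀ, A(B_x)]]`, `M` the incidence matrix. -/
theorem adjMatrix_wholeGraph {P B : Type*} (R : Type*) [Ring R]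
    (blk : B → Finset P) (x : ℕ) :
    (wholeGraph blk x).adjMatrix R =
      Matrix.fromBlocks ((Matrix.of fun _ _ => 1) - 1) (incidenceMatrix R blk)
        (incidenceMatrix R blk)ᵀ ((blockGraph blk x).adjMatrix R) := by
  ext (p | i) (q | j)
  · by_cases h : p = q <;>
      simp [wholeGraph, pointBlockGraph, SimpleGraph.adjMatrix_apply, h]
  all_goals simp [wholeGraph, pointBlockGraph, incidenceMatrix, SimpleGraph.adjMatrix_apply]

end

/-! Let T be the adjacency matrix with blocks D, M, Mᵀ, A, where D is O or J − I and A belongs to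
the block graph. The parameter conditions make T² − (θ₁ + θ₂)T + θ₁θ₂I equal to a matrix N with
constant blocks lJ, sJ, sJ, mJ. The point block comes from MMᵀ = (r − λ)I + λJ. The mixed block
comes from evaluating MMᵀM in two ways, which expresses MA through M and J. The block part comes
from MᵀM and the strong regularity of the block graph.

The square root condition says s² = lm, so N has rank one. As a polynomial in T, N commutes with T;
hence TN = θ₀N for some θ₀, and T is annihilated by (z − θ₀)(z − θ₁)(z − θ₂). No quadratic
annihilates T, because two nonadjacent blocks have a common neighbour, so all three roots are
eigenvalues. This is `IsQSD.isG3_pointBlockGraph`, which also gives (θ₀ − d)(θ₀ − e₀) = rk and θ₀ >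
d, with d the valency of D: θ₀ is the larger root. For the whole graph this is the stated formula;
for the total graph the row sums of the matrix identities yield θ₀ = e₀ − θ₂.

For the coherent rank, the combinations of I, J on points, of M, J and their transposes off the
diagonal, and of I, A, J on blocks form a coherent algebra of dimension 9. If points and blocks have
different valencies, row sums separate the two classes inside the coherent closure, which then
contains each of these nine matrices. -/

section ThreeEigenvalues

open Classical

/-- The all-ones matrix. -/
def allOnes (m n R : Type*) [One R] : Matrix m n R := Matrix.of fun _ _ => 1

@[simp]
theorem allOnes_apply {m n R : Type*} [One R] (i : m) (j : n) : allOnes m n R i j = 1 := rfl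

@[simp]
theorem transpose_allOnes (m n R : Type*) [One R] : (allOnes m n R)ᵀ = allOnes n m R := rfl

theorem allOnes_mul_allOnes (m n o R : Type*) [Fintype n] [CommRing R] :
    allOnes m n R * allOnes n o R = (Fintype.card n : R) • allOnes m o R := by
  ext i j
  simp [Matrix.mul_apply]

/-! ### Polynomial identities for real matrices -/

section Spectrum

variable {V : Type*} [Fintype V]

/-- The product kills every vector of an orthonormal eigenbasis, since one of its factors vanishes
on each. -/
theorem Matrix.IsHermitian.mul_sub_smul_one_eq_zero {A : Matrix V V ℝ} (hA : A.IsHermitian)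
    {a b c : ℝ} (hs : spectrum ℝ A = {a, b, c}) :
    (A - a • 1) * ((A - b • 1) * (A - c • 1)) = 0 := by
  set X := (A - a • 1) * ((A - b • 1) * (A - c • 1)) with hX
  have key : ∀ j, X *ᵥ (hA.eigenvectorBasis j).ofLp = 0 := by
    intro j
    have h1 := hA.mulVec_eigenvectorBasis j
    have h2 : hA.eigenvalues j ∈ ({a, b, c} : Set ℝ) := hs ▸ hA.eigenvalues_mem_spectrum_real j
    set μ := hA.eigenvalues j
    set u := (hA.eigenvectorBasis j).ofLp
    have h3 : ∀ t : ℝ, (A - t • 1) *ᵥ u = (μ - t) • u := by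
      intro t
      rw [Matrix.sub_mulVec, h1, Matrix.smul_mulVec, Matrix.one_mulVec, sub_smul]
    rw [hX, ← Matrix.mulVec_mulVec, ← Matrix.mulVec_mulVec, h3, Matrix.mulVec_smul, h3,
      Matrix.mulVec_smul, Matrix.mulVec_smul, h3, smul_smul, smul_smul]
    have : (μ - c) * (μ - b) * (μ - a) = 0 := by
      rcases h2 with h | h | h
      · simp [h]
      · simp [h]
      · simp [Set.mem_singleton_iff.1 h]
    rw [this, zero_smul]
  have hU : X * (hA.eigenvectorUnitary : Matrix V V ℝ) = 0 := by
    ext i j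
    exact congrFun (key j) i
  calc X = X * ((hA.eigenvectorUnitary : Matrix V V ℝ) *
        star (hA.eigenvectorUnitary : Matrix V V ℝ)) := by
        rw [Unitary.mul_star_self_of_mem hA.eigenvectorUnitary.2, mul_one]
    _ = 0 := by rw [← mul_assoc, hU, zero_mul]

theorem exists_mulVec_eq_smul_of_mem_spectrum {A : Matrix V V ℝ} {a : ℝ}
    (ha : a ∈ spectrum ℝ A) : ∃ f : V → ℝ, f ≠ 0 ∧ A *ᵥ f = a • f := by
  rw [spectrum.mem_iff, Matrix.isUnit_iff_isUnit_det, isUnit_iff_ne_zero, not_not] at ha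
  obtain ⟨f, hf, h⟩ := Matrix.exists_mulVec_eq_zero_iff.2 ha
  refine ⟨f, hf, ?_⟩
  rw [Matrix.sub_mulVec, Algebra.algebraMap_eq_smul_one, Matrix.smul_mulVec, Matrix.one_mulVec,
    sub_eq_zero] at h
  exact h.symm

/-- The entry at (u, w) excludes every quadratic relation for T. If one of a, b, c were not an
eigenvalue, its factor could be cancelled from the cubic, leaving such a relation. -/
theorem spectrum_eq_of_mul_eq_zero [DecidableEq V] {T : Matrix V V ℝ} {a b c : ℝ}
    (h : (T - a • 1) * ((T - b • 1) * (T - c • 1)) = 0) {u w : V} (huw : u ≠ w)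
    (h0 : T u w = 0) (h2 : (T * T) u w ≠ 0) : spectrum ℝ T = {a, b, c} := by
  have comm : ∀ s t : ℝ, (T - s • 1) * (T - t • 1) = (T - t • 1) * (T - s • 1) := by
    intro s t
    simp only [sub_mul, mul_sub, smul_mul_assoc, mul_smul_comm, one_mul, mul_one]
    module
  have prod_ne : ∀ s t : ℝ, (T - s • 1) * (T - t • 1) ≠ 0 := by
    intro s t hst
    have h3 := congrFun (congrFun hst u) w
    simp only [sub_mul, mul_sub, smul_mul_assoc, mul_smul_comm, one_mul, mul_one,
      Matrix.sub_apply, Matrix.smul_apply, h0, Matrix.one_apply_ne huw, Matrix.zero_apply,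
      smul_zero, sub_zero] at h3
    exact h2 h3
  have mem_of : ∀ s t z : ℝ, (T - s • 1) * ((T - t • 1) * (T - z • 1)) = 0 →
      s ∈ spectrum ℝ T := by
    intro s t z hz
    rw [spectrum.mem_iff]
    intro hu
    have hu' : IsUnit (T - s • (1 : Matrix V V ℝ)) := by
      have := hu.neg
      rwa [neg_sub, Algebra.algebraMap_eq_smul_one] at this
    exact prod_ne t z ((hu'.mul_right_eq_zero).1 hz)
  apply Set.Subset.antisymm
  · intro μ hμ
    by_contra hn
    simp only [Set.mem_insert_iff, Set.mem_singleton_iff, not_or] at hn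
    rw [spectrum.mem_iff, Matrix.isUnit_iff_isUnit_det, isUnit_iff_ne_zero, not_not] at hμ
    obtain ⟨f, hf, hf0⟩ := Matrix.exists_mulVec_eq_zero_iff.2 hμ
    rw [Matrix.sub_mulVec, Algebra.algebraMap_eq_smul_one, Matrix.smul_mulVec,
      Matrix.one_mulVec, sub_eq_zero] at hf0
    have h3 : ∀ t : ℝ, (T - t • 1) *ᵥ f = (μ - t) • f := by
      intro t
      rw [Matrix.sub_mulVec, ← hf0, Matrix.smul_mulVec, Matrix.one_mulVec, sub_smul]
    have h4 := congrArg (· *ᵥ f) h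
    simp only [← Matrix.mulVec_mulVec, h3, Matrix.mulVec_smul, smul_smul,
      Matrix.zero_mulVec, smul_eq_zero, mul_eq_zero, sub_eq_zero] at h4
    tauto
  · rintro μ (rfl | rfl | hμ)
    · exact mem_of _ _ _ h
    · refine mem_of μ a c ?_
      rw [← mul_assoc, comm μ a, mul_assoc, h]
    · rw [Set.mem_singleton_iff.1 hμ]
      refine mem_of c a b ?_
      rw [← mul_assoc, comm c a, mul_assoc, comm c b, h]

end Spectrum

/-! ### Connected regular graphs with three eigenvalues -/

section Regular

variable {V : Type*} [Fintype V] {G : SimpleGraph V}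

theorem SimpleGraph.IsRegularOfDegree.adjMatrix_mul_allOnes {d : ℕ} (hd : G.IsRegularOfDegree d)
    (R W : Type*) [CommRing R] : G.adjMatrix R * allOnes V W R = (d : R) • allOnes V W R := by
  ext i j
  change (G.adjMatrix R *ᵥ Function.const V 1) i = _
  simp [hd i]

theorem SimpleGraph.IsRegularOfDegree.allOnes_mul_adjMatrix {d : ℕ} (hd : G.IsRegularOfDegree d)
    (R W : Type*) [CommRing R] : allOnes W V R * G.adjMatrix R = (d : R) • allOnes W V R := by
  have := congrArg Matrix.transpose (hd.adjMatrix_mul_allOnes R W)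
  simpa [Matrix.transpose_mul] using this

/-- Evaluate the eigenvector equation at a coordinate of largest modulus. -/
theorem SimpleGraph.IsRegularOfDegree.le_degree_of_mem_spectrum {d : ℕ}
    (hd : G.IsRegularOfDegree d) {a : ℝ} (ha : a ∈ spectrum ℝ (G.adjMatrix ℝ)) : a ≤ d := by
  obtain ⟨f, hf, h⟩ := exists_mulVec_eq_smul_of_mem_spectrum ha
  obtain ⟨i₀, hi₀⟩ := Function.ne_iff.1 hf
  obtain ⟨i, -, hi⟩ := Finset.exists_max_image Finset.univ (fun i => |f i|) ⟨i₀, Finset.mem_univ _⟩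
  have hpos : 0 < |f i| := (abs_pos.2 hi₀).trans_le (hi i₀ (Finset.mem_univ _))
  have h1 := congrFun h i
  rw [SimpleGraph.adjMatrix_mulVec_apply, Pi.smul_apply, smul_eq_mul] at h1
  have h2 : |a * f i| ≤ d * |f i| := by
    rw [← h1]
    calc |∑ u ∈ G.neighborFinset i, f u| ≤ ∑ u ∈ G.neighborFinset i, |f u| :=
          Finset.abs_sum_le_sum_abs _ _
      _ ≤ ∑ u ∈ G.neighborFinset i, |f i| := Finset.sum_le_sum fun u _ => hi u (Finset.mem_univ _)
      _ = d * |f i| := by simp [hd i]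
  rw [abs_mul] at h2
  exact (le_abs_self a).trans (le_of_mul_le_mul_right h2 hpos)

theorem SimpleGraph.IsRegularOfDegree.degree_mem_spectrum [Nonempty V] {d : ℕ}
    (hd : G.IsRegularOfDegree d) : (d : ℝ) ∈ spectrum ℝ (G.adjMatrix ℝ) := by
  rw [spectrum.mem_iff, Matrix.isUnit_iff_isUnit_det, isUnit_iff_ne_zero, not_not]
  refine Matrix.exists_mulVec_eq_zero_iff.1 ⟨Function.const V 1, ?_, ?_⟩
  · exact Function.const_ne_zero.2 one_ne_zero
  · rw [Matrix.sub_mulVec, Algebra.algebraMap_eq_smul_one, Matrix.smul_mulVec, Matrix.one_mulVec]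
    ext i
    simp [hd i]

theorem IsG3.degree_eq {d : ℕ} (hd : G.IsRegularOfDegree d) {a b c : ℝ} (h : IsG3 G a b c) :
    (d : ℝ) = a := by
  obtain ⟨hc, h1, h2, hs⟩ := h
  have := hc.nonempty
  have h3 := hd.degree_mem_spectrum
  have h4 := hd.le_degree_of_mem_spectrum (a := a) (by rw [hs]; simp)
  rw [hs] at h3
  rcases h3 with h | h | h
  · exact h
  · linarith
  · rw [Set.mem_singleton_iff] at h
    linarith

/-- For a regular graph such an f lies in the kernel of the Laplacian. -/
theorem SimpleGraph.Connected.eq_of_adjMatrix_mulVec {d : ℕ} (hc : G.Connected)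
    (hd : G.IsRegularOfDegree d) {f : V → ℝ} (hf : G.adjMatrix ℝ *ᵥ f = (d : ℝ) • f) (i j : V) :
    f i = f j := by
  refine G.lapMatrix_mulVec_eq_zero_iff_forall_reachable.1 ?_ i j (hc.preconnected i j)
  ext v
  have := congrFun hf v
  rw [SimpleGraph.adjMatrix_mulVec_apply, Pi.smul_apply, smul_eq_mul] at this
  rw [SimpleGraph.lapMatrix_mulVec_apply, this, hd v]
  simp

/-- A regular graph in `𝒢₃(a, b, c)` is strongly regular. -/
theorem IsG3.exists_adjMatrix_mul_self {d : ℕ} (hd : G.IsRegularOfDegree d) {a b c : ℝ}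
    (h : IsG3 G a b c) : ∃ t : ℝ, 0 < t ∧ G.adjMatrix ℝ * G.adjMatrix ℝ =
      (b + c) • G.adjMatrix ℝ - (b * c) • 1 + t • allOnes V V ℝ := by
  have hda := h.degree_eq hd
  obtain ⟨hc, h1, h2, hs⟩ := h
  have hz := (G.isHermitian_adjMatrix ℝ).mul_sub_smul_one_eq_zero hs
  set A := G.adjMatrix ℝ with hA
  set C := (A - b • 1) * (A - c • 1) with hC
  have hCe : C = A * A - (b + c) • A + (b * c) • 1 := by
    simp only [hC, sub_mul, mul_sub, smul_mul_assoc, mul_smul_comm, one_mul, mul_one]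
    module
  have hsymm : Cᵀ = C := by
    simp [hCe, hA, Matrix.transpose_mul]
  -- Since (A − a)C = 0, each column of C is an eigenvector for the valency, hence constant;
  -- symmetry then makes C a multiple of J.
  have hcol : ∀ i i' j, C i j = C i' j := by
    intro i i' j
    refine hc.eq_of_adjMatrix_mulVec hd (f := fun i => C i j) ?_ i i'
    ext v
    have := congrFun (congrFun hz v) j
    rw [sub_mul, smul_mul_assoc, one_mul, Matrix.sub_apply, Matrix.smul_apply, Matrix.zero_apply,
      sub_eq_zero] at this
    rw [hda]
    exact this
  obtain ⟨i₀⟩ := hc.nonempty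
  have hCt : C = C i₀ i₀ • allOnes V V ℝ := by
    ext i j
    rw [Matrix.smul_apply, allOnes_apply, smul_eq_mul, mul_one, hcol i i₀ j]
    have := congrFun (congrFun hsymm i₀) j
    rw [← this, Matrix.transpose_apply, hcol j i₀]
  refine ⟨C i₀ i₀, ?_, ?_⟩
  -- The sign of the multiple follows from the eigenvalue (a − b)(a − c) > 0 of C on the all-ones
  -- vector.
  · have h3 : C * allOnes V V ℝ = ((a - b) * (a - c)) • allOnes V V ℝ := by
      simp only [hCe, add_mul, sub_mul, smul_mul_assoc, one_mul, mul_assoc,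
        hd.adjMatrix_mul_allOnes, mul_smul_comm, hA, hda]
      module
    rw [hCt, smul_mul_assoc, allOnes_mul_allOnes, smul_smul] at h3
    have h4 := congrFun (congrFun h3 i₀) i₀
    simp only [Matrix.smul_apply, allOnes_apply, smul_eq_mul, mul_one] at h4
    have h5 : 0 < (a - b) * (a - c) := mul_pos (by linarith) (by linarith)
    rw [← h4] at h5
    exact pos_of_mul_pos_left h5 (Nat.cast_nonneg _)
  · rw [← hCt, hCe]
    module

end Regular

/-! ### Incidence matrices of quasi-symmetric designs -/

theorem incidenceMatrix_apply {P B : Type*} (R : Type*) [Zero R] [One R] (blk : B → Finset P)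
    (p : P) (i : B) : incidenceMatrix R blk p i = if p ∈ blk i then 1 else 0 := rfl

theorem blockGraph_adj {P B : Type*} (blk : B → Finset P) (x : ℕ) (i j : B) :
    (blockGraph blk x).Adj i j ↔ i ≠ j ∧ (blk i ∩ blk j).card = x := Iff.rfl

theorem adjMatrix_pointBlockGraph {P B : Type*} (H : SimpleGraph P) (blk : B → Finset P) (x : ℕ)
    (R : Type*) [Zero R] [One R] : (pointBlockGraph H blk x).adjMatrix R =
      Matrix.fromBlocks (H.adjMatrix R) (incidenceMatrix R blk) (incidenceMatrix R blk)ᵀ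
        ((blockGraph blk x).adjMatrix R) := by
  ext (p | i) (q | j) <;> rw [SimpleGraph.adjMatrix_apply]
  · exact if_congr Iff.rfl rfl rfl
  · exact if_congr Iff.rfl rfl rfl
  · exact if_congr Iff.rfl rfl rfl
  · exact if_congr Iff.rfl rfl rfl

section Design

variable {P B : Type*} [Fintype P] [Fintype B] {blk : B → Finset P} {v k lam b r x y : ℕ}


theorem IsTDesign.allOnes_mul_incidenceMatrix (h : IsTDesign blk 2 v k lam)
    (R Q : Type*) [CommRing R] :
    allOnes Q P R * incidenceMatrix R blk = (k : R) • allOnes Q B R := by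
  ext q i
  simp [Matrix.mul_apply, incidenceMatrix_apply, h.card_block i]

theorem IsTDesign.transpose_incidenceMatrix_mul_allOnes (h : IsTDesign blk 2 v k lam)
    (R Q : Type*) [CommRing R] :
    (incidenceMatrix R blk)ᵀ * allOnes P Q R = (k : R) • allOnes B Q R := by
  have := congrArg Matrix.transpose (h.allOnes_mul_incidenceMatrix R Q)
  simpa [Matrix.transpose_mul] using this

theorem IsQSD.incidenceMatrix_mul_allOnes (hQ : IsQSD blk v k lam b r x y)
    (R Q : Type*) [CommRing R] :
    incidenceMatrix R blk * allOnes B Q R = (r : R) • allOnes P Q R := by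
  ext p q
  simp [Matrix.mul_apply, incidenceMatrix_apply, hQ.card_blocks_through p]

theorem IsQSD.allOnes_mul_transpose_incidenceMatrix (hQ : IsQSD blk v k lam b r x y)
    (R Q : Type*) [CommRing R] :
    allOnes Q B R * (incidenceMatrix R blk)ᵀ = (r : R) • allOnes Q P R := by
  have := congrArg Matrix.transpose (hQ.incidenceMatrix_mul_allOnes R Q)
  simpa [Matrix.transpose_mul] using this

theorem IsQSD.incidenceMatrix_mul_transpose (hQ : IsQSD blk v k lam b r x y)
    (R : Type*) [CommRing R] : incidenceMatrix R blk * (incidenceMatrix R blk)ᵀ =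
      ((r : R) - lam) • 1 + (lam : R) • allOnes P P R := by
  ext p q
  have h1 : (incidenceMatrix R blk * (incidenceMatrix R blk)ᵀ) p q =
      ((Finset.univ.filter fun i => p ∈ blk i ∧ q ∈ blk i).card : R) := by
    simp [Matrix.mul_apply, incidenceMatrix_apply, ← ite_and, and_comm]
  rw [h1]
  by_cases hpq : p = q
  · subst hpq
    simp [hQ.card_blocks_through p]
  · have h2 := hQ.isDesign.card_blocks_superset {p, q} (Finset.card_pair hpq)
    simp only [Finset.insert_subset_iff, Finset.singleton_subset_iff] at h2
    simp [h2, Matrix.one_apply_ne hpq]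

theorem IsQSD.transpose_mul_incidenceMatrix (hQ : IsQSD blk v k lam b r x y)
    (R : Type*) [CommRing R] : (incidenceMatrix R blk)ᵀ * incidenceMatrix R blk =
      ((k : R) - y) • 1 + ((x : R) - y) • (blockGraph blk x).adjMatrix R +
        (y : R) • allOnes B B R := by
  ext i j
  have h1 : ((incidenceMatrix R blk)ᵀ * incidenceMatrix R blk) i j =
      ((blk i ∩ blk j).card : R) := by
    simp [Matrix.mul_apply, incidenceMatrix_apply, ← ite_and, ← Finset.mem_inter,
      Finset.inter_comm]
  rw [h1]
  by_cases hij : i = j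
  · subst hij
    simp [hQ.isDesign.card_block i]
  · by_cases hx : (blk i ∩ blk j).card = x
    · simp [SimpleGraph.adjMatrix_apply, blockGraph_adj, hij, hx]
    · have hy := (hQ.card_inter i j hij).resolve_left hx
      simp [SimpleGraph.adjMatrix_apply, blockGraph_adj, hij, hy, hQ.x_ne_y.symm]

theorem IsQSD.exists_adj (hQ : IsQSD blk v k lam b r x y) :
    ∃ i j, (blockGraph blk x).Adj i j := hQ.exists_inter_eq_x

theorem IsQSD.exists_ne_not_adj (hQ : IsQSD blk v k lam b r x y) :
    ∃ i j, i ≠ j ∧ ¬ (blockGraph blk x).Adj i j := by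
  obtain ⟨i, j, hij, h⟩ := hQ.exists_inter_eq_y
  exact ⟨i, j, hij, fun h' => hQ.x_ne_y (h'.2.symm.trans h)⟩

theorem IsQSD.exists_mem (hQ : IsQSD blk v k lam b r x y) : ∃ p i, p ∈ blk i := by
  obtain ⟨i, -, -⟩ := hQ.exists_inter_eq_x
  obtain ⟨p, hp⟩ := Finset.card_pos.1
    ((Nat.lt_of_lt_of_le one_pos hQ.isDesign.one_le_k).trans_eq (hQ.isDesign.card_block i).symm)
  exact ⟨p, i, hp⟩

/-- If all blocks were the full point set, only one intersection size could occur. -/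
theorem IsQSD.exists_not_mem (hQ : IsQSD blk v k lam b r x y) : ∃ p i, p ∉ blk i := by
  by_contra! h
  have hu : ∀ i, blk i = Finset.univ := fun i => Finset.eq_univ_iff_forall.2 fun p => h p i
  obtain ⟨i, j, -, h1⟩ := hQ.exists_inter_eq_x
  obtain ⟨i', j', -, h2⟩ := hQ.exists_inter_eq_y
  apply hQ.x_ne_y
  rw [← h1, ← h2, hu, hu, hu, hu]

theorem IsQSD.r_pos (hQ : IsQSD blk v k lam b r x y) : 0 < r := by
  obtain ⟨p, i, hp⟩ := hQ.exists_mem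
  rw [← hQ.card_blocks_through p]
  exact Finset.card_pos.2 ⟨i, by simpa using hp⟩

theorem IsQSD.exists_mem_block (hQ : IsQSD blk v k lam b r x y) (p : P) : ∃ i, p ∈ blk i := by
  obtain ⟨i, hi⟩ := Finset.card_pos.1 (hQ.r_pos.trans_eq (hQ.card_blocks_through p).symm)
  exact ⟨i, by simpa using hi⟩

theorem IsQSD.nontrivial_points (hQ : IsQSD blk v k lam b r x y) : Nontrivial P := by
  obtain ⟨p, i, hp⟩ := hQ.exists_not_mem
  obtain ⟨q, hq⟩ := Finset.card_pos.1
    ((Nat.lt_of_lt_of_le one_pos hQ.isDesign.one_le_k).trans_eq (hQ.isDesign.card_block i).symm)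
  exact ⟨p, q, fun h => hp (h ▸ hq)⟩

theorem IsQSD.cast_sub_ne_zero (hQ : IsQSD blk v k lam b r x y) (R : Type*) [Field R]
    [CharZero R] : (x : R) - y ≠ 0 :=
  sub_ne_zero.2 (Nat.cast_injective.ne hQ.x_ne_y)

/-- MᵀM has constant row sums rk and is a combination of I, A and J in which A has the nonzero
coefficient x − y. -/
theorem IsQSD.exists_isRegularOfDegree (hQ : IsQSD blk v k lam b r x y) :
    ∃ d, (blockGraph blk x).IsRegularOfDegree d := by
  have key : ∀ i, ((x : ℝ) - y) * (blockGraph blk x).degree i = r * k - (k - y) - y * b := by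
    intro i
    have h1 : (incidenceMatrix ℝ blk)ᵀ * incidenceMatrix ℝ blk * allOnes B Unit ℝ =
        ((r : ℝ) * k) • allOnes B Unit ℝ := by
      rw [Matrix.mul_assoc, hQ.incidenceMatrix_mul_allOnes, Matrix.mul_smul,
        hQ.isDesign.transpose_incidenceMatrix_mul_allOnes, smul_smul]
    have h2 : ((blockGraph blk x).adjMatrix ℝ * allOnes B Unit ℝ) i () =
        (blockGraph blk x).degree i := by
      change ((blockGraph blk x).adjMatrix ℝ *ᵥ Function.const B 1) i = _
      simp
    have h3 := congrFun (congrFun h1 i) ()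
    rw [hQ.transpose_mul_incidenceMatrix, Matrix.add_mul, Matrix.add_mul, Matrix.smul_mul,
      Matrix.smul_mul, Matrix.smul_mul, Matrix.one_mul, allOnes_mul_allOnes, Matrix.add_apply,
      Matrix.add_apply, Matrix.smul_apply, Matrix.smul_apply, h2, hQ.card_blocks] at h3
    simp only [Matrix.smul_apply, allOnes_apply, smul_eq_mul, mul_one] at h3
    linarith
  obtain ⟨i₀, -, -⟩ := hQ.exists_adj
  refine ⟨(blockGraph blk x).degree i₀, fun i => ?_⟩
  exact_mod_cast mul_left_cancel₀ (hQ.cast_sub_ne_zero ℝ) ((key i).trans (key i₀).symm)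

/-- In a quasi-symmetric design, the incidence matrix times the adjacency
matrix of the block graph is a combination of the incidence matrix and the all-ones matrix. -/
theorem IsQSD.incidenceMatrix_mul_adjMatrix (hQ : IsQSD blk v k lam b r x y)
    (R : Type*) [Field R] [CharZero R] :
    incidenceMatrix R blk * (blockGraph blk x).adjMatrix R =
      (((r : R) - lam + y - k) / (x - y)) • incidenceMatrix R blk +
        (((lam : R) * k - y * r) / (x - y)) • allOnes P B R := by
  have hxy := hQ.cast_sub_ne_zero R
  set M := incidenceMatrix R blk with hM
  set A := (blockGraph blk x).adjMatrix R with hA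
  -- The left side is a combination of M and J; the right side contains (x − y)MA, and x ≠ y.
  have h1 : M * Mᵀ * M = M * (Mᵀ * M) := Matrix.mul_assoc _ _ _
  rw [hQ.incidenceMatrix_mul_transpose, hQ.transpose_mul_incidenceMatrix, ← hA] at h1
  simp only [Matrix.add_mul, Matrix.mul_add, Matrix.smul_mul, Matrix.mul_smul, Matrix.one_mul,
    Matrix.mul_one, hM, hQ.isDesign.allOnes_mul_incidenceMatrix,
    hQ.incidenceMatrix_mul_allOnes] at h1
  rw [← hM] at h1
  have h2 : ((x : R) - y) • (M * A) =
      ((r : R) - lam + y - k) • M + ((lam : R) * k - y * r) • allOnes P B R := by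
    calc ((x : R) - y) • (M * A) = (((r : R) - lam) • M + (lam : R) • (k : R) • allOnes P B R) -
          ((k : R) - y) • M - (y : R) • (r : R) • allOnes P B R := by rw [h1]; abel
      _ = _ := by module
  calc M * A = ((x : R) - y)⁻¹ • (((x : R) - y) • (M * A)) := by
        rw [smul_smul, inv_mul_cancel₀ hxy, one_smul]
    _ = _ := by
        rw [h2, smul_add, smul_smul, smul_smul, div_eq_inv_mul, div_eq_inv_mul]

theorem pointBlockGraph_connected (hQ : IsQSD blk v k lam b r x y) (H : SimpleGraph P)
    (hc : (blockGraph blk x).Connected) : (pointBlockGraph H blk x).Connected := by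
  have hBB : ∀ i j : B, (pointBlockGraph H blk x).Reachable (Sum.inr i) (Sum.inr j) := by
    intro i j
    exact (hc.preconnected i j).map
      (⟨Sum.inr, fun h => h⟩ : blockGraph blk x →g pointBlockGraph H blk x)
  have hPB : ∀ u : P ⊕ B, ∃ i : B, (pointBlockGraph H blk x).Reachable u (Sum.inr i) := by
    rintro (p | i)
    · obtain ⟨i, hi⟩ := hQ.exists_mem_block p
      have : (pointBlockGraph H blk x).Adj (Sum.inl p) (Sum.inr i) := hi
      exact ⟨i, this.reachable⟩
    · exact ⟨i, SimpleGraph.Reachable.refl _⟩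
  have := hc.nonempty
  refine { preconnected := fun u w => ?_, nonempty := inferInstance }
  obtain ⟨i, hi⟩ := hPB u
  obtain ⟨j, hj⟩ := hPB w
  exact (hi.trans (hBB i j)).trans hj.symm

end Design

/-! ### The spectrum of the total graph and of the whole graph -/

/-- `Matrix.fromBlocks_one` for an arbitrary decidable equality on the sum type. -/
theorem one_eq_fromBlocks (P B R : Type*) [DecidableEq (P ⊕ B)] [Zero R] [One R] :
    (1 : Matrix (P ⊕ B) (P ⊕ B) R) = Matrix.fromBlocks 1 0 0 1 := by
  rw [Matrix.fromBlocks_one]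
  ext i j
  simp [Matrix.one_apply]

theorem smul_allOnes_inj {m n R : Type*} [CommRing R] [Nonempty m] [Nonempty n] {a b : R}
    (h : a • allOnes m n R = b • allOnes m n R) : a = b := by
  obtain ⟨i⟩ := ‹Nonempty m›
  obtain ⟨j⟩ := ‹Nonempty n›
  simpa using congrFun (congrFun h i) j

section Spectrum

variable {P B : Type*} [Fintype P] [Fintype B] {blk : B → Finset P} {v k lam b r x y : ℕ}

/-- Common core of both cases: the last three hypotheses are the blocks of T² = N + (θ₁ + θ₂)T −
θ₁θ₂I with N of rank one, and d is the valency on the points. -/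
theorem IsQSD.isG3_pointBlockGraph (hQ : IsQSD blk v k lam b r x y) (H : SimpleGraph P)
    {d l s m e₀ e₁ e₂ θ₁ θ₂ : ℝ} (hG : IsG3 (blockGraph blk x) e₀ e₁ e₂)
    (hDP : H.adjMatrix ℝ * allOnes P P ℝ = d • allOnes P P ℝ)
    (hDB : H.adjMatrix ℝ * allOnes P B ℝ = d • allOnes P B ℝ)
    (hd : 0 ≤ d) (hm : 0 < m) (hs : s = √(l * m)) (hθ₁ : θ₂ < θ₁) (hθ₂ : θ₂ < 0)
    (hPP : H.adjMatrix ℝ * H.adjMatrix ℝ + incidenceMatrix ℝ blk * (incidenceMatrix ℝ blk)ᵀ =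
      l • allOnes P P ℝ + (θ₁ + θ₂) • H.adjMatrix ℝ - (θ₁ * θ₂) • 1)
    (hPB : H.adjMatrix ℝ * incidenceMatrix ℝ blk +
        incidenceMatrix ℝ blk * (blockGraph blk x).adjMatrix ℝ =
      s • allOnes P B ℝ + (θ₁ + θ₂) • incidenceMatrix ℝ blk)
    (hBB : (incidenceMatrix ℝ blk)ᵀ * incidenceMatrix ℝ blk +
        (blockGraph blk x).adjMatrix ℝ * (blockGraph blk x).adjMatrix ℝ =
      m • allOnes B B ℝ + (θ₁ + θ₂) • (blockGraph blk x).adjMatrix ℝ - (θ₁ * θ₂) • 1) :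
    ∃ θ₀, 0 < s ∧ 0 < l ∧ d < θ₀ ∧ (θ₀ - d) * (θ₀ - e₀) = r * k ∧
      IsG3 (pointBlockGraph H blk x) θ₀ θ₁ θ₂ := by
  obtain ⟨c, hreg⟩ := hQ.exists_isRegularOfDegree
  have hc : (c : ℝ) = e₀ := hG.degree_eq hreg
  obtain ⟨p₀, i₀, -⟩ := hQ.exists_mem
  have : Nonempty P := ⟨p₀⟩
  have : Nonempty B := ⟨i₀⟩
  have hr : (0 : ℝ) < r := Nat.cast_pos.2 hQ.r_pos
  have hk : (0 : ℝ) < k := Nat.cast_pos.2 hQ.isDesign.one_le_k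
  have he : 0 ≤ e₀ := hc ▸ Nat.cast_nonneg c
  have hAJ : (blockGraph blk x).adjMatrix ℝ * allOnes B B ℝ = e₀ • allOnes B B ℝ :=
    hc ▸ hreg.adjMatrix_mul_allOnes ℝ B
  have hAJ' : (blockGraph blk x).adjMatrix ℝ * allOnes B P ℝ = e₀ • allOnes B P ℝ :=
    hc ▸ hreg.adjMatrix_mul_allOnes ℝ P
  have hJA : allOnes P B ℝ * (blockGraph blk x).adjMatrix ℝ = e₀ • allOnes P B ℝ :=
    hc ▸ hreg.allOnes_mul_adjMatrix ℝ P
  set N : Matrix (P ⊕ B) (P ⊕ B) ℝ := Matrix.fromBlocks (l • allOnes P P ℝ) (s • allOnes P B ℝ)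
    (s • allOnes B P ℝ) (m • allOnes B B ℝ) with hN
  set T := (pointBlockGraph H blk x).adjMatrix ℝ with hT
  have hTb : T = Matrix.fromBlocks (H.adjMatrix ℝ) (incidenceMatrix ℝ blk)
    (incidenceMatrix ℝ blk)ᵀ ((blockGraph blk x).adjMatrix ℝ) :=
    adjMatrix_pointBlockGraph H blk x ℝ
  have hBP := congrArg Matrix.transpose hPB
  simp only [Matrix.transpose_add, Matrix.transpose_mul, Matrix.transpose_smul,
    SimpleGraph.transpose_adjMatrix, transpose_allOnes] at hBP
  have hTT : T * T = N + (θ₁ + θ₂) • T - (θ₁ * θ₂) • 1 := by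
    rw [one_eq_fromBlocks, hTb, hN, Matrix.fromBlocks_multiply, hPP, hPB, hBB, hBP]
    simp only [Matrix.fromBlocks_smul, Matrix.fromBlocks_add, Matrix.fromBlocks_neg, smul_zero,
      neg_zero, add_zero, sub_eq_add_neg]
  have hNe : N = T * T - (θ₁ + θ₂) • T + (θ₁ * θ₂) • 1 := by rw [hTT]; module
  have hcomm : T * N = N * T := by
    rw [hNe]
    simp only [mul_add, add_mul, mul_sub, sub_mul, mul_smul_comm, smul_mul_assoc, mul_one,
      one_mul, mul_assoc]
  have hTN : T * N = Matrix.fromBlocks ((d * l + r * s) • allOnes P P ℝ)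
      ((d * s + r * m) • allOnes P B ℝ) ((k * l + e₀ * s) • allOnes B P ℝ)
      ((k * s + e₀ * m) • allOnes B B ℝ) := by
    rw [hTb, hN, Matrix.fromBlocks_multiply]
    simp only [Matrix.mul_smul, hDP, hDB, hQ.incidenceMatrix_mul_allOnes, hAJ, hAJ',
      hQ.isDesign.transpose_incidenceMatrix_mul_allOnes]
    congr 1 <;> module
  -- The mixed block of TN = NT.
  have hrel : d * s + r * m = k * l + e₀ * s := by
    rw [hTN, hTb, hN, Matrix.fromBlocks_multiply] at hcomm
    have h := (Matrix.fromBlocks_inj.1 hcomm).2.1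
    rw [Matrix.smul_mul, Matrix.smul_mul, hQ.isDesign.allOnes_mul_incidenceMatrix, hJA,
      smul_smul, smul_smul, ← add_smul] at h
    rw [smul_allOnes_inj h]
    ring
  -- For l ≤ 0 the real square root takes its default value 0, and `hrel` becomes rm = kl, with a
  -- positive left and a nonpositive right side.
  have hl : 0 < l := by
    by_contra hl
    push Not at hl
    have hs0 : s = 0 := by
      rw [hs]
      exact Real.sqrt_eq_zero'.2 (mul_nonpos_of_nonpos_of_nonneg hl hm.le)
    rw [hs0] at hrel
    nlinarith [mul_pos hr hm, mul_nonneg hk.le (neg_nonneg.2 hl)]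
  have hs0 : 0 < s := hs ▸ Real.sqrt_pos.2 (mul_pos hl hm)
  have hss : s * s = l * m := hs ▸ Real.mul_self_sqrt (mul_pos hl hm).le
  -- θ₀ is read off the mixed block of TN = θ₀N; the relation s² = lm carries it to the diagonal
  -- blocks.
  obtain ⟨θ₀, hθ₀⟩ : ∃ θ₀, θ₀ * s = d * s + r * m :=
    ⟨(d * s + r * m) / s, div_mul_cancel₀ _ hs0.ne'⟩
  have h1 : θ₀ * l = d * l + r * s := by
    refine mul_right_cancel₀ hm.ne' ?_
    linear_combination (θ₀ - d) * (-hss) + s * hθ₀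
  have h2 : θ₀ * m = k * s + e₀ * m := by
    refine mul_left_cancel₀ hs0.ne' ?_
    linear_combination m * hθ₀ + m * hrel - k * hss
  have hlt : d < θ₀ := by
    have : 0 < (θ₀ - d) * s := by linarith [mul_pos hr hm]
    linarith [pos_of_mul_pos_left this hs0.le]
  have hTN' : T * N = θ₀ • N := by
    rw [hTN, hN, Matrix.fromBlocks_smul, ← hrel, ← hθ₀, ← h1, ← h2]
    simp only [mul_smul]
  have hNN : N * N = ((θ₀ - θ₁) * (θ₀ - θ₂)) • N := by
    have : N * N = T * (T * N) - (θ₁ + θ₂) • (T * N) + (θ₁ * θ₂) • N := by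
      conv_lhs => rw [hNe, add_mul, sub_mul, smul_mul_assoc, smul_mul_assoc, one_mul, mul_assoc]
      rw [← hNe]
    rw [this, hTN', mul_smul_comm, hTN']
    module
  -- N² = (θ₀ − θ₁)(θ₀ − θ₂)N, and the block part of N² is positive; the second factor is positive
  -- because θ₀ > d ≥ 0 > θ₂.
  have hgt : θ₁ < θ₀ := by
    rw [hN, Matrix.fromBlocks_multiply, Matrix.fromBlocks_smul] at hNN
    have h := (Matrix.fromBlocks_inj.1 hNN).2.2.2
    simp only [Matrix.smul_mul, Matrix.mul_smul, allOnes_mul_allOnes, smul_smul,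
      ← add_smul] at h
    have h := smul_allOnes_inj h
    have hcard : (0 : ℝ) < Fintype.card P := Nat.cast_pos.2 Fintype.card_pos
    have h3 : 0 < (θ₀ - θ₁) * (θ₀ - θ₂) * m := by
      rw [← h]
      positivity
    have h4 := pos_of_mul_pos_left h3 hm.le
    linarith [pos_of_mul_pos_left h4 (by linarith)]
  refine ⟨θ₀, hs0, hl, hlt, ?_, pointBlockGraph_connected hQ H hG.1, hθ₁, hgt, ?_⟩
  · refine mul_right_cancel₀ (mul_pos hs0 hm).ne' ?_
    linear_combination (θ₀ - e₀) * m * hθ₀ + r * m * h2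
  -- For two distinct nonadjacent blocks the entry of T is 0 and that of T² is m > 0.
  · obtain ⟨i, j, hij, hadj⟩ := hQ.exists_ne_not_adj
    have hTij : T (Sum.inr i) (Sum.inr j) = 0 := by
      rw [hTb, Matrix.fromBlocks_apply₂₂, SimpleGraph.adjMatrix_apply, if_neg hadj]
    have hspec : spectrum ℝ T = {θ₀, θ₁, θ₂} := by
      refine spectrum_eq_of_mul_eq_zero ?_ (Sum.inr_injective.ne hij) hTij ?_
      · have : (T - θ₁ • 1) * (T - θ₂ • 1) = N := by
          rw [hNe]
          simp only [sub_mul, mul_sub, smul_mul_assoc, mul_smul_comm, one_mul, mul_one]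
          module
        rw [this, sub_mul, hTN', smul_mul_assoc, one_mul, sub_self]
      · rw [hTT, Matrix.sub_apply, Matrix.add_apply, Matrix.smul_apply, Matrix.smul_apply, hTij,
          Matrix.one_apply_ne (Sum.inr_injective.ne hij), hN]
        simpa using hm.ne'
    convert hspec

end Spectrum

/-! ### The coherent rank of the total graph and of the whole graph -/

/-- To compute the coherent rank of `G`, it suffices to find a coherent algebra containing the
adjacency matrix that is contained in each such algebra. -/
theorem coherentRank_eq_finrank {V : Type*} [Fintype V] (G : SimpleGraph V)
    (S : Submodule ℂ (Matrix V V ℂ)) (one_mem : 1 ∈ S) (allOnes_mem : allOnes V V ℂ ∈ S)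
    (adj_mem : G.adjMatrix ℂ ∈ S) (transpose_mem : ∀ X ∈ S, Xᵀ ∈ S)
    (mul_mem : ∀ X ∈ S, ∀ Y ∈ S, X * Y ∈ S) (hadamard_mem : ∀ X ∈ S, ∀ Y ∈ S, X ⊙ Y ∈ S)
    (le : ∀ C : Submodule ℂ (Matrix V V ℂ), 1 ∈ C → allOnes V V ℂ ∈ C → G.adjMatrix ℂ ∈ C →
      (∀ X ∈ C, ∀ Y ∈ C, X * Y ∈ C) → (∀ X ∈ C, ∀ Y ∈ C, X ⊙ Y ∈ C) → S ≤ C) :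
    coherentRank G = Module.finrank ℂ S := by
  have h : Subalgebra.toSubmodule (coherentClosure G) = S := by
    apply le_antisymm
    · have hS : IsCoherentAlgebra (S.toSubalgebra one_mem fun X Y hX hY => mul_mem X hX Y hY) :=
        ⟨allOnes_mem, transpose_mem, hadamard_mem⟩
      exact coherentClosure_le G hS adj_mem
    · have hC := coherentClosure_isCoherentAlgebra G
      exact le _ (coherentClosure G).one_mem hC.allOnes_mem
        (adjMatrix_mem_coherentClosure G) (fun X hX Y hY => (coherentClosure G).mul_mem hX hY)
        hC.hadamard_mem
  rw [← h]
  rfl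

/-! ### Closure properties of spans, reduced to generators -/

theorem Matrix.mul_mem_of_mem_span {l m n : Type*} [Fintype m] {s : Set (Matrix l m ℂ)}
    {t : Set (Matrix m n ℂ)} {S : Submodule ℂ (Matrix l n ℂ)}
    (h : ∀ X ∈ s, ∀ Y ∈ t, X * Y ∈ S) {X : Matrix l m ℂ} (hX : X ∈ Submodule.span ℂ s)
    {Y : Matrix m n ℂ} (hY : Y ∈ Submodule.span ℂ t) : X * Y ∈ S := by
  induction hX using Submodule.span_induction with
  | mem X hX =>
    induction hY using Submodule.span_induction with
    | mem Y hY => exact h X hX Y hY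
    | zero => simp
    | add Y Z _ _ hY hZ => rw [Matrix.mul_add]; exact S.add_mem hY hZ
    | smul a Y _ hY => rw [Matrix.mul_smul]; exact S.smul_mem a hY
  | zero => simp
  | add X Z _ _ hX hZ => rw [Matrix.add_mul]; exact S.add_mem hX hZ
  | smul a X _ hX => rw [Matrix.smul_mul]; exact S.smul_mem a hX

theorem Matrix.hadamard_mem_of_mem_span {m n : Type*} {s t : Set (Matrix m n ℂ)}
    {S : Submodule ℂ (Matrix m n ℂ)}
    (h : ∀ X ∈ s, ∀ Y ∈ t, X ⊙ Y ∈ S) {X : Matrix m n ℂ} (hX : X ∈ Submodule.span ℂ s)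
    {Y : Matrix m n ℂ} (hY : Y ∈ Submodule.span ℂ t) : X ⊙ Y ∈ S := by
  induction hX using Submodule.span_induction with
  | mem X hX =>
    induction hY using Submodule.span_induction with
    | mem Y hY => exact h X hX Y hY
    | zero => simp
    | add Y Z _ _ hY hZ => rw [Matrix.hadamard_add]; exact S.add_mem hY hZ
    | smul a Y _ hY => rw [Matrix.hadamard_smul]; exact S.smul_mem a hY
  | zero => simp
  | add X Z _ _ hX hZ => rw [Matrix.add_hadamard]; exact S.add_mem hX hZ
  | smul a X _ hX => rw [Matrix.smul_hadamard]; exact S.smul_mem a hX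

theorem Matrix.transpose_mem_of_mem_span {m n : Type*} {s : Set (Matrix m n ℂ)}
    {S : Submodule ℂ (Matrix n m ℂ)} (h : ∀ X ∈ s, Xᵀ ∈ S) {X : Matrix m n ℂ}
    (hX : X ∈ Submodule.span ℂ s) : Xᵀ ∈ S := by
  induction hX using Submodule.span_induction with
  | mem X hX => exact h X hX
  | zero => simp
  | add X Z _ _ hX hZ => rw [Matrix.transpose_add]; exact S.add_mem hX hZ
  | smul a X _ hX => rw [Matrix.transpose_smul]; exact S.smul_mem a hX

@[simp]
theorem hadamard_allOnes {m n R : Type*} [MulOneClass R] (X : Matrix m n R) :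
    X ⊙ allOnes m n R = X := by
  ext i j
  simp [Matrix.hadamard_apply]

@[simp]
theorem allOnes_hadamard {m n R : Type*} [MulOneClass R] (X : Matrix m n R) :
    allOnes m n R ⊙ X = X := by
  ext i j
  simp [Matrix.hadamard_apply]

theorem incidenceMatrix_hadamard_self {P B : Type*} (R : Type*) [MulZeroOneClass R]
    (blk : B → Finset P) :
    incidenceMatrix R blk ⊙ incidenceMatrix R blk = incidenceMatrix R blk := by
  ext p i
  by_cases h : p ∈ blk i <;> simp [Matrix.hadamard_apply, incidenceMatrix_apply, h]

theorem transpose_incidenceMatrix_hadamard_self {P B : Type*} (R : Type*) [MulZeroOneClass R]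
    (blk : B → Finset P) :
    (incidenceMatrix R blk)ᵀ ⊙ (incidenceMatrix R blk)ᵀ = (incidenceMatrix R blk)ᵀ :=
  congrArg Matrix.transpose (incidenceMatrix_hadamard_self R blk)

theorem SimpleGraph.adjMatrix_hadamard_adjMatrix {V : Type*} (G : SimpleGraph V) (R : Type*)
    [MulZeroOneClass R] : G.adjMatrix R ⊙ G.adjMatrix R = G.adjMatrix R := by
  ext i j
  by_cases h : G.Adj i j <;> simp [Matrix.hadamard_apply, SimpleGraph.adjMatrix_apply, h]

theorem Matrix.one_hadamard_one {V R : Type*} [MulZeroOneClass R] :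
    (1 : Matrix V V R) ⊙ 1 = 1 := by
  ext i j
  by_cases h : i = j
  · subst h
    simp [Matrix.hadamard_apply]
  · simp [Matrix.hadamard_apply, Matrix.one_apply_ne h]

theorem SimpleGraph.one_hadamard_adjMatrix_eq_zero {V : Type*} (G : SimpleGraph V) (R : Type*)
    [MulZeroOneClass R] : (1 : Matrix V V R) ⊙ G.adjMatrix R = 0 := by
  ext i j
  by_cases h : i = j
  · simp [Matrix.hadamard_apply, h]
  · simp [Matrix.hadamard_apply, Matrix.one_apply_ne h]

theorem SimpleGraph.adjMatrix_hadamard_one_eq_zero {V : Type*} (G : SimpleGraph V) (R : Type*)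
    [MulZeroOneClass R] : G.adjMatrix R ⊙ (1 : Matrix V V R) = 0 := by
  ext i j
  by_cases h : i = j
  · simp [Matrix.hadamard_apply, h]
  · simp [Matrix.hadamard_apply, Matrix.one_apply_ne h]

/-- The combinations of `I` and `J` on the points, of the incidence matrix and `J` off the
diagonal, and of `I`, `J` and the adjacency matrix of the block graph on the blocks. -/
noncomputable def blockCombination {P B : Type*} (blk : B → Finset P) (x : ℕ) :
    (Fin 9 → ℂ) →ₗ[ℂ] Matrix (P ⊕ B) (P ⊕ B) ℂ where
  toFun c := Matrix.fromBlocks (c 0 • 1 + c 1 • allOnes P P ℂ)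
    (c 2 • incidenceMatrix ℂ blk + c 3 • allOnes P B ℂ)
    (c 4 • (incidenceMatrix ℂ blk)ᵀ + c 5 • allOnes B P ℂ)
    (c 6 • 1 + c 7 • (blockGraph blk x).adjMatrix ℂ + c 8 • allOnes B B ℂ)
  map_add' c c' := by
    rw [Matrix.fromBlocks_add]
    congr 1 <;> simp only [Pi.add_apply] <;> module
  map_smul' a c := by
    rw [Matrix.fromBlocks_smul]
    congr 1 <;> simp only [Pi.smul_apply, smul_eq_mul, RingHom.id_apply] <;> module

theorem blockCombination_apply {P B : Type*} (blk : B → Finset P) (x : ℕ) (c : Fin 9 → ℂ) :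
    blockCombination blk x c = Matrix.fromBlocks (c 0 • 1 + c 1 • allOnes P P ℂ)
      (c 2 • incidenceMatrix ℂ blk + c 3 • allOnes P B ℂ)
      (c 4 • (incidenceMatrix ℂ blk)ᵀ + c 5 • allOnes B P ℂ)
      (c 6 • 1 + c 7 • (blockGraph blk x).adjMatrix ℂ + c 8 • allOnes B B ℂ) := rfl

/-- Reduces the closure properties to one span for each of the four blocks. -/
theorem fromBlocks_mem_range_blockCombination {P B : Type*} {blk : B → Finset P} {x : ℕ}
    {X : Matrix P P ℂ} {Y : Matrix P B ℂ} {Z : Matrix B P ℂ} {W : Matrix B B ℂ} :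
    Matrix.fromBlocks X Y Z W ∈ LinearMap.range (blockCombination blk x) ↔
      X ∈ Submodule.span ℂ {1, allOnes P P ℂ} ∧
      Y ∈ Submodule.span ℂ {incidenceMatrix ℂ blk, allOnes P B ℂ} ∧
      Z ∈ Submodule.span ℂ {(incidenceMatrix ℂ blk)ᵀ, allOnes B P ℂ} ∧
      W ∈ Submodule.span ℂ {1, (blockGraph blk x).adjMatrix ℂ, allOnes B B ℂ} := by
  simp only [Submodule.mem_span_pair, Submodule.mem_span_triple, LinearMap.mem_range,
    blockCombination_apply, Matrix.fromBlocks_inj]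
  constructor
  · rintro ⟨c, h1, h2, h3, h4⟩
    exact ⟨⟨_, _, h1⟩, ⟨_, _, h2⟩, ⟨_, _, h3⟩, ⟨_, _, _, h4⟩⟩
  · rintro ⟨⟨c0, c1, h1⟩, ⟨c2, c3, h2⟩, ⟨c4, c5, h3⟩, ⟨c6, c7, c8, h4⟩⟩
    exact ⟨![c0, c1, c2, c3, c4, c5, c6, c7, c8], h1, h2, h3, h4⟩

theorem hadamard_mem_range_blockCombination {P B : Type*} {blk : B → Finset P} {x : ℕ}
    {X Y : Matrix (P ⊕ B) (P ⊕ B) ℂ} (hX : X ∈ LinearMap.range (blockCombination blk x))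
    (hY : Y ∈ LinearMap.range (blockCombination blk x)) :
    X ⊙ Y ∈ LinearMap.range (blockCombination blk x) := by
  rw [← Matrix.fromBlocks_toBlocks X, fromBlocks_mem_range_blockCombination] at hX
  rw [← Matrix.fromBlocks_toBlocks Y, fromBlocks_mem_range_blockCombination] at hY
  obtain ⟨hX1, hX2, hX3, hX4⟩ := hX
  obtain ⟨hY1, hY2, hY3, hY4⟩ := hY
  rw [← Matrix.fromBlocks_toBlocks (X ⊙ Y), fromBlocks_mem_range_blockCombination]
  refine ⟨Matrix.hadamard_mem_of_mem_span ?_ hX1 hY1, Matrix.hadamard_mem_of_mem_span ?_ hX2 hY2,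
    Matrix.hadamard_mem_of_mem_span ?_ hX3 hY3, Matrix.hadamard_mem_of_mem_span ?_ hX4 hY4⟩ <;>
  simp only [Set.mem_insert_iff, Set.mem_singleton_iff, forall_eq_or_imp, forall_eq,
    hadamard_allOnes, allOnes_hadamard, incidenceMatrix_hadamard_self,
    transpose_incidenceMatrix_hadamard_self, SimpleGraph.adjMatrix_hadamard_adjMatrix,
    SimpleGraph.one_hadamard_adjMatrix_eq_zero, SimpleGraph.adjMatrix_hadamard_one_eq_zero,
    Matrix.one_hadamard_one, zero_mem, true_and] <;>
  repeat' first
    | apply And.intro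
    | exact Submodule.subset_span (by simp)

theorem transpose_mem_range_blockCombination {P B : Type*} {blk : B → Finset P} {x : ℕ}
    {X : Matrix (P ⊕ B) (P ⊕ B) ℂ} (hX : X ∈ LinearMap.range (blockCombination blk x)) :
    Xᵀ ∈ LinearMap.range (blockCombination blk x) := by
  rw [← Matrix.fromBlocks_toBlocks X, fromBlocks_mem_range_blockCombination] at hX
  obtain ⟨hX1, hX2, hX3, hX4⟩ := hX
  rw [← Matrix.fromBlocks_toBlocks X, Matrix.fromBlocks_transpose,
    fromBlocks_mem_range_blockCombination]
  refine ⟨Matrix.transpose_mem_of_mem_span ?_ hX1, Matrix.transpose_mem_of_mem_span ?_ hX3,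
    Matrix.transpose_mem_of_mem_span ?_ hX2, Matrix.transpose_mem_of_mem_span ?_ hX4⟩ <;>
  simp only [Set.mem_insert_iff, Set.mem_singleton_iff, forall_eq_or_imp, forall_eq,
    transpose_allOnes, Matrix.transpose_one, Matrix.transpose_transpose,
    SimpleGraph.transpose_adjMatrix] <;>
  repeat' first
    | apply And.intro
    | exact Submodule.subset_span (by simp)

/-! ### Dimension nine and minimality of the algebra -/

section Rank

variable {P B : Type*} [Fintype P] [Fintype B]

variable {blk : B → Finset P} {v k lam b r x y : ℕ}

/-- Suitable entries isolate the coefficients: distinct points, incident and non-incident pairs,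
adjacent and nonadjacent blocks all exist. -/
theorem IsQSD.injective_blockCombination (hQ : IsQSD blk v k lam b r x y) :
    Function.Injective (blockCombination blk x) := by
  rw [← LinearMap.ker_eq_bot, LinearMap.ker_eq_bot']
  intro c hc
  have e : ∀ u w, blockCombination blk x c u w = 0 := fun u w => by rw [hc]; rfl
  simp only [blockCombination_apply] at e
  obtain ⟨p, p', hp⟩ := hQ.nontrivial_points
  obtain ⟨p₁, i₁, h₁⟩ := hQ.exists_mem
  obtain ⟨p₂, i₂, h₂⟩ := hQ.exists_not_mem
  obtain ⟨i₃, j₃, h₃⟩ := hQ.exists_adj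
  obtain ⟨i₄, j₄, hne, h₄⟩ := hQ.exists_ne_not_adj
  have c1 : c 1 = 0 := by simpa [Matrix.one_apply_ne hp] using e (Sum.inl p) (Sum.inl p')
  have c0 : c 0 = 0 := by simpa [c1] using e (Sum.inl p) (Sum.inl p)
  have c3 : c 3 = 0 := by simpa [incidenceMatrix_apply, h₂] using e (Sum.inl p₂) (Sum.inr i₂)
  have c2 : c 2 = 0 := by
    simpa [incidenceMatrix_apply, h₁, c3] using e (Sum.inl p₁) (Sum.inr i₁)
  have c5 : c 5 = 0 := by simpa [incidenceMatrix_apply, h₂] using e (Sum.inr i₂) (Sum.inl p₂)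
  have c4 : c 4 = 0 := by
    simpa [incidenceMatrix_apply, h₁, c5] using e (Sum.inr i₁) (Sum.inl p₁)
  have c8 : c 8 = 0 := by
    simpa [SimpleGraph.adjMatrix_apply, h₄, Matrix.one_apply_ne hne] using
      e (Sum.inr i₄) (Sum.inr j₄)
  have c7 : c 7 = 0 := by
    simpa [SimpleGraph.adjMatrix_apply, h₃, Matrix.one_apply_ne h₃.1, c8] using
      e (Sum.inr i₃) (Sum.inr j₃)
  have c6 : c 6 = 0 := by
    simpa [SimpleGraph.adjMatrix_apply, c7, c8] using e (Sum.inr i₁) (Sum.inr i₁)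
  ext i
  fin_cases i <;> assumption

theorem IsQSD.mul_mem_range_blockCombination (hQ : IsQSD blk v k lam b r x y)
    (hAA : (blockGraph blk x).adjMatrix ℂ * (blockGraph blk x).adjMatrix ℂ ∈
      Submodule.span ℂ {1, (blockGraph blk x).adjMatrix ℂ, allOnes B B ℂ})
    {X Y : Matrix (P ⊕ B) (P ⊕ B) ℂ} (hX : X ∈ LinearMap.range (blockCombination blk x))
    (hY : Y ∈ LinearMap.range (blockCombination blk x)) :
    X * Y ∈ LinearMap.range (blockCombination blk x) := by
  obtain ⟨d, hd⟩ := hQ.exists_isRegularOfDegree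
  have hMA := hQ.incidenceMatrix_mul_adjMatrix ℂ
  have hAM := congrArg Matrix.transpose hMA
  simp only [Matrix.transpose_add, Matrix.transpose_mul, Matrix.transpose_smul,
    SimpleGraph.transpose_adjMatrix, transpose_allOnes] at hAM
  rw [← Matrix.fromBlocks_toBlocks X, fromBlocks_mem_range_blockCombination] at hX
  rw [← Matrix.fromBlocks_toBlocks Y, fromBlocks_mem_range_blockCombination] at hY
  obtain ⟨hX1, hX2, hX3, hX4⟩ := hX
  obtain ⟨hY1, hY2, hY3, hY4⟩ := hY
  rw [← Matrix.fromBlocks_toBlocks X, ← Matrix.fromBlocks_toBlocks Y, Matrix.fromBlocks_multiply,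
    fromBlocks_mem_range_blockCombination]
  set S1 := Submodule.span ℂ {1, allOnes P P ℂ} with hS1
  set S2 := Submodule.span ℂ {incidenceMatrix ℂ blk, allOnes P B ℂ} with hS2
  set S3 := Submodule.span ℂ {(incidenceMatrix ℂ blk)ᵀ, allOnes B P ℂ} with hS3
  set S4 := Submodule.span ℂ {1, (blockGraph blk x).adjMatrix ℂ, allOnes B B ℂ} with hS4
  have m11 : (1 : Matrix P P ℂ) ∈ S1 := Submodule.subset_span (by simp)
  have m12 : allOnes P P ℂ ∈ S1 := Submodule.subset_span (by simp)
  have m21 : incidenceMatrix ℂ blk ∈ S2 := Submodule.subset_span (by simp)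
  have m22 : allOnes P B ℂ ∈ S2 := Submodule.subset_span (by simp)
  have m31 : (incidenceMatrix ℂ blk)ᵀ ∈ S3 := Submodule.subset_span (by simp)
  have m32 : allOnes B P ℂ ∈ S3 := Submodule.subset_span (by simp)
  have m41 : (1 : Matrix B B ℂ) ∈ S4 := Submodule.subset_span (by simp)
  have m42 : (blockGraph blk x).adjMatrix ℂ ∈ S4 := Submodule.subset_span (by simp)
  have m43 : allOnes B B ℂ ∈ S4 := Submodule.subset_span (by simp)
  refine ⟨add_mem (Matrix.mul_mem_of_mem_span ?_ hX1 hY1) (Matrix.mul_mem_of_mem_span ?_ hX2 hY3),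
    add_mem (Matrix.mul_mem_of_mem_span ?_ hX1 hY2) (Matrix.mul_mem_of_mem_span ?_ hX2 hY4),
    add_mem (Matrix.mul_mem_of_mem_span ?_ hX3 hY1) (Matrix.mul_mem_of_mem_span ?_ hX4 hY3),
    add_mem (Matrix.mul_mem_of_mem_span ?_ hX3 hY2) (Matrix.mul_mem_of_mem_span ?_ hX4 hY4)⟩ <;>
  simp only [Set.mem_insert_iff, Set.mem_singleton_iff, forall_eq_or_imp, forall_eq,
    Matrix.one_mul, Matrix.mul_one, allOnes_mul_allOnes, hQ.incidenceMatrix_mul_allOnes,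
    hQ.incidenceMatrix_mul_transpose, hQ.transpose_mul_incidenceMatrix,
    hQ.allOnes_mul_transpose_incidenceMatrix, hQ.isDesign.allOnes_mul_incidenceMatrix,
    hQ.isDesign.transpose_incidenceMatrix_mul_allOnes, hd.adjMatrix_mul_allOnes,
    hd.allOnes_mul_adjMatrix, hMA, hAM] <;>
  repeat' first
    | assumption
    | apply And.intro
    | apply Submodule.add_mem
    | apply Submodule.smul_mem

theorem fromBlocks_sub {l m n o R : Type*} [AddGroup R] (X X' : Matrix l n R) (Y Y' : Matrix l o R)
    (Z Z' : Matrix m n R) (W W' : Matrix m o R) :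
    Matrix.fromBlocks X Y Z W - Matrix.fromBlocks X' Y' Z' W' =
      Matrix.fromBlocks (X - X') (Y - Y') (Z - Z') (W - W') := by
  ext (i | i) (j | j) <;> rfl

/-- If the points and the blocks have different degrees, then every matrix space containing the
adjacency matrix with the closure properties of a coherent algebra contains all combinations. -/
theorem IsQSD.range_blockCombination_le (hQ : IsQSD blk v k lam b r x y) (H : SimpleGraph P)
    {d e : ℕ} (hH : H.IsRegularOfDegree d) (hB : (blockGraph blk x).IsRegularOfDegree e)
    (hne : d + r ≠ k + e) {C : Submodule ℂ (Matrix (P ⊕ B) (P ⊕ B) ℂ)}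
    (one_mem : Matrix.fromBlocks 1 0 0 1 ∈ C) (allOnes_mem : allOnes (P ⊕ B) (P ⊕ B) ℂ ∈ C)
    (adj_mem : (pointBlockGraph H blk x).adjMatrix ℂ ∈ C)
    (mul_mem : ∀ X ∈ C, ∀ Y ∈ C, X * Y ∈ C) (hadamard_mem : ∀ X ∈ C, ∀ Y ∈ C, X ⊙ Y ∈ C) :
    LinearMap.range (blockCombination blk x) ≤ C := by
  have hJ : allOnes (P ⊕ B) (P ⊕ B) ℂ = Matrix.fromBlocks (allOnes P P ℂ) (allOnes P B ℂ)
      (allOnes B P ℂ) (allOnes B B ℂ) := by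
    ext (i | i) (j | j) <;> rfl
  rw [hJ] at allOnes_mem
  rw [adjMatrix_pointBlockGraph] at adj_mem
  have hrow : Matrix.fromBlocks (allOnes P P ℂ) (allOnes P B ℂ) 0 0 ∈ C := by
    -- TJ has rows constant d + r on points and k + e on blocks, so TJ − (k + e)J lives on the point
    -- rows, with the nonzero constant d + r − (k + e).
    have h := C.sub_mem (mul_mem _ adj_mem _ allOnes_mem) (C.smul_mem ((k : ℂ) + e) allOnes_mem)
    have hne' : (d + r - (k + e) : ℂ) ≠ 0 := sub_ne_zero.2 (by exact_mod_cast hne)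
    have h2 := C.smul_mem (d + r - (k + e) : ℂ)⁻¹ h
    rw [Matrix.fromBlocks_multiply, Matrix.fromBlocks_smul, fromBlocks_sub,
      hH.adjMatrix_mul_allOnes, hH.adjMatrix_mul_allOnes,
      hB.adjMatrix_mul_allOnes, hB.adjMatrix_mul_allOnes, hQ.incidenceMatrix_mul_allOnes,
      hQ.incidenceMatrix_mul_allOnes, hQ.isDesign.transpose_incidenceMatrix_mul_allOnes,
      hQ.isDesign.transpose_incidenceMatrix_mul_allOnes] at h2
    simp only [← add_smul, ← sub_smul, sub_self, Matrix.fromBlocks_smul,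
      smul_smul, inv_mul_cancel₀ hne', one_smul, smul_zero] at h2
    exact h2
  have hE : Matrix.fromBlocks (1 : Matrix P P ℂ) 0 0 (0 : Matrix B B ℂ) ∈ C := by
    have h := hadamard_mem _ hrow _ one_mem
    convert h using 1
    ext (i | i) (j | j) <;> simp [Matrix.hadamard_apply, -Matrix.fromBlocks_one]
  have hF : Matrix.fromBlocks (0 : Matrix P P ℂ) 0 0 (1 : Matrix B B ℂ) ∈ C := by
    simpa [fromBlocks_sub, -Matrix.fromBlocks_one] using C.sub_mem one_mem hE
  -- The identities of the two classes, as left and right factors, cut out each block.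
  have corner : ∀ {X : Matrix P P ℂ} {Y : Matrix P B ℂ} {Z : Matrix B P ℂ} {W : Matrix B B ℂ},
      Matrix.fromBlocks X Y Z W ∈ C →
      Matrix.fromBlocks X 0 0 0 ∈ C ∧ Matrix.fromBlocks 0 Y 0 0 ∈ C ∧
      Matrix.fromBlocks 0 0 Z 0 ∈ C ∧ Matrix.fromBlocks 0 0 0 W ∈ C := by
    intro X Y Z W h
    have h1 := mul_mem _ (mul_mem _ hE _ h) _ hE
    have h2 := mul_mem _ (mul_mem _ hE _ h) _ hF
    have h3 := mul_mem _ (mul_mem _ hF _ h) _ hE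
    have h4 := mul_mem _ (mul_mem _ hF _ h) _ hF
    simp only [Matrix.fromBlocks_multiply, Matrix.one_mul, Matrix.mul_one, Matrix.zero_mul,
      Matrix.mul_zero, add_zero, zero_add] at h1 h2 h3 h4
    exact ⟨h1, h2, h3, h4⟩
  obtain ⟨m0, -, -, m6⟩ := corner one_mem
  obtain ⟨m1, m3, m5, m8⟩ := corner allOnes_mem
  obtain ⟨-, m2, m4, m7⟩ := corner adj_mem
  rintro _ ⟨c, rfl⟩
  have h := C.add_mem (C.add_mem (C.add_mem (C.add_mem (C.smul_mem (c 0) m0) (C.smul_mem (c 1) m1))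
    (C.add_mem (C.smul_mem (c 2) m2) (C.smul_mem (c 3) m3)))
    (C.add_mem (C.smul_mem (c 4) m4) (C.smul_mem (c 5) m5)))
    (C.add_mem (C.add_mem (C.smul_mem (c 6) m6) (C.smul_mem (c 7) m7)) (C.smul_mem (c 8) m8))
  rw [blockCombination_apply]
  simpa only [Matrix.fromBlocks_smul, Matrix.fromBlocks_add, smul_zero, add_zero, zero_add] using h

theorem IsQSD.coherentRank_pointBlockGraph (hQ : IsQSD blk v k lam b r x y) (H : SimpleGraph P)
    {d e : ℕ} (hH : H.IsRegularOfDegree d) (hB : (blockGraph blk x).IsRegularOfDegree e)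
    (hHs : H.adjMatrix ℂ ∈ Submodule.span ℂ {1, allOnes P P ℂ})
    (hAA : (blockGraph blk x).adjMatrix ℂ * (blockGraph blk x).adjMatrix ℂ ∈
      Submodule.span ℂ {1, (blockGraph blk x).adjMatrix ℂ, allOnes B B ℂ})
    (hne : d + r ≠ k + e) : coherentRank (pointBlockGraph H blk x) = 9 := by
  rw [coherentRank_eq_finrank _ (LinearMap.range (blockCombination blk x)),
    LinearMap.finrank_range_of_inj hQ.injective_blockCombination, Module.finrank_fin_fun]
  · rw [one_eq_fromBlocks, fromBlocks_mem_range_blockCombination]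
    exact ⟨Submodule.subset_span (by simp), zero_mem _, zero_mem _, Submodule.subset_span (by simp)⟩
  · rw [← Matrix.fromBlocks_toBlocks (allOnes _ _ _), fromBlocks_mem_range_blockCombination]
    exact ⟨Submodule.subset_span (Or.inr rfl), Submodule.subset_span (Or.inr rfl),
      Submodule.subset_span (Or.inr rfl), Submodule.subset_span (Or.inr (Or.inr rfl))⟩
  · rw [adjMatrix_pointBlockGraph, fromBlocks_mem_range_blockCombination]
    exact ⟨hHs, Submodule.subset_span (by simp), Submodule.subset_span (by simp),
      Submodule.subset_span (by simp)⟩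
  · exact fun X hX => transpose_mem_range_blockCombination hX
  · exact fun X hX Y hY => hQ.mul_mem_range_blockCombination hAA hX hY
  · exact fun X hX Y hY => hadamard_mem_range_blockCombination hX hY
  · exact fun C h1 hJ hA hmul hhad => hQ.range_blockCombination_le H hH hB hne
      (by rwa [one_eq_fromBlocks] at h1) hJ hA hmul hhad

/-- The strongly regular relation, transported entrywise from ℝ to ℂ. -/
theorem IsG3.adjMatrix_mul_self_mem_span {V : Type*} [Fintype V] {G : SimpleGraph V} {d : ℕ}
    (hd : G.IsRegularOfDegree d) {e₀ e₁ e₂ : ℝ} (h : IsG3 G e₀ e₁ e₂) :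
    G.adjMatrix ℂ * G.adjMatrix ℂ ∈ Submodule.span ℂ {1, G.adjMatrix ℂ, allOnes V V ℂ} := by
  obtain ⟨t, -, ht⟩ := h.exists_adjMatrix_mul_self hd
  rw [Submodule.mem_span_triple]
  refine ⟨-((e₁ : ℂ) * e₂), (e₁ : ℂ) + e₂, (t : ℂ), ?_⟩
  ext i j
  have h1 := congrArg (Complex.ofReal) (congrFun (congrFun ht i) j)
  simp only [Matrix.mul_apply, SimpleGraph.adjMatrix_apply, Matrix.add_apply, Matrix.sub_apply,
    Matrix.smul_apply, allOnes_apply, Matrix.one_apply, smul_eq_mul] at h1 ⊢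
  push_cast [apply_ite Complex.ofReal] at h1
  rw [h1]
  ring

end Rank

/-! ### The parameter conditions and the value of θ₀ -/

section Main

variable {P B : Type*} [Fintype P] [Fintype B] {blk : B → Finset P} {v k lam b r x y : ℕ}

/-- The block part of `(T - θ₁)(T - θ₂)` is a multiple of the all-ones matrix. -/
theorem IsQSD.block_quadratic_relation (hQ : IsQSD blk v k lam b r x y) {θ₁ θ₂ e₀ e₁ e₂ : ℝ}
    (hG : IsG3 (blockGraph blk x) e₀ e₁ e₂)
    (hx : (x : ℝ) = k + (θ₁ + 1) * (θ₂ + 1) - (e₁ + 1) * (e₂ + 1))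
    (hy : (y : ℝ) = k + θ₁ * θ₂ - e₁ * e₂) :
    0 < k + e₀ + θ₁ * θ₂ ∧ (incidenceMatrix ℝ blk)ᵀ * incidenceMatrix ℝ blk +
        (blockGraph blk x).adjMatrix ℝ * (blockGraph blk x).adjMatrix ℝ =
      (k + e₀ + θ₁ * θ₂) • allOnes B B ℝ + (θ₁ + θ₂) • (blockGraph blk x).adjMatrix ℝ -
        (θ₁ * θ₂) • 1 := by
  obtain ⟨d, hd⟩ := hQ.exists_isRegularOfDegree
  obtain ⟨t, ht, hAA⟩ := hG.exists_adjMatrix_mul_self hd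
  have he := hG.degree_eq hd
  obtain ⟨-, i, -⟩ := hQ.exists_mem
  have hdiag := congrFun (congrFun hAA i) i
  simp only [SimpleGraph.adjMatrix_mul_self_apply_self, hd i, he, Matrix.add_apply,
    Matrix.sub_apply, Matrix.smul_apply, SimpleGraph.adjMatrix_apply, SimpleGraph.irrefl,
    if_false, Matrix.one_apply_eq, allOnes_apply, smul_eq_mul, mul_one, mul_zero, zero_sub]
    at hdiag
  -- The diagonal of A² gives e₀ = t − e₁e₂. The formulas for x and y amount to x − y + e₁ + e₂ = θ₁
  -- + θ₂ and k − y − e₁e₂ = −θ₁θ₂.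
  have hm : (k + e₀ + θ₁ * θ₂ : ℝ) = y + t := by linarith
  refine ⟨hm ▸ add_pos_of_nonneg_of_pos (Nat.cast_nonneg _) ht, ?_⟩
  rw [hQ.transpose_mul_incidenceMatrix, hAA, hm, hx, hy]
  module

theorem SimpleGraph.adjMatrix_of_eq_top {V : Type*} {G : SimpleGraph V} (hG : G = ⊤)
    (R : Type*) [CommRing R] : G.adjMatrix R = allOnes V V R - 1 := by
  ext i j
  by_cases h : i = j <;> simp [SimpleGraph.adjMatrix_apply, hG, h]

theorem SimpleGraph.adjMatrix_of_eq_bot {V : Type*} {G : SimpleGraph V} (hG : G = ⊥)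
    (R : Type*) [CommRing R] : G.adjMatrix R = 0 := by
  ext i j
  simp [SimpleGraph.adjMatrix_apply, hG]

/-- Here d = 0 and l = λ. The quotient matrix with rows (0, r) and (k, e₀) has θ₀ as a root of p(z)
= z² − e₀z − rk; it remains to see that θ₂ is the other one. -/
theorem IsQSD.isG3_totalGraph (hQ : IsQSD blk v k lam b r x y) {θ₁ θ₂ e₀ e₁ e₂ : ℝ}
    (hθ₁ : 0 < θ₁) (hθ₂ : θ₂ < 0) (hG : IsG3 (blockGraph blk x) e₀ e₁ e₂)
    (hx : (x : ℝ) = k + (θ₁ + 1) * (θ₂ + 1) - (e₁ + 1) * (e₂ + 1))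
    (hy : (y : ℝ) = k + θ₁ * θ₂ - e₁ * e₂)
    (hlam : (lam : ℝ) = r + θ₁ * θ₂) (hsum : ((r : ℝ) - lam + y - k) / (x - y) = θ₁ + θ₂)
    (hs : ((lam : ℝ) * k - y * r) / (x - y) = √(lam * (k + e₀ + θ₁ * θ₂))) :
    IsG3 (totalGraph blk x) (e₀ - θ₂) θ₁ θ₂ := by
  obtain ⟨hm, hBB⟩ := hQ.block_quadratic_relation hG hx hy
  have hMA := hQ.incidenceMatrix_mul_adjMatrix ℝ
  rw [hsum, hs] at hMA
  obtain ⟨θ₀, hs0, hlam0, hθ₀, hprod, h⟩ := hQ.isG3_pointBlockGraph ⊥ (d := 0) (l := lam) hG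
    (by simp [SimpleGraph.adjMatrix_of_eq_bot (G := ⊥) rfl])
    (by simp [SimpleGraph.adjMatrix_of_eq_bot (G := ⊥) rfl]) le_rfl hm rfl (hθ₂.trans hθ₁) hθ₂
    (by
      rw [SimpleGraph.adjMatrix_of_eq_bot (G := ⊥) rfl, hQ.incidenceMatrix_mul_transpose, hlam,
        Matrix.mul_zero]
      module)
    (by
      rw [SimpleGraph.adjMatrix_of_eq_bot (G := ⊥) rfl, hMA, Matrix.zero_mul]
      module)
    hBB
  have hss := Real.mul_self_sqrt (mul_pos hlam0 hm).le
  set s := √(lam * (k + e₀ + θ₁ * θ₂))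
  obtain ⟨d, hd⟩ := hQ.exists_isRegularOfDegree
  obtain ⟨p, i, -⟩ := hQ.exists_mem
  have : Nonempty P := ⟨p⟩
  have : Nonempty B := ⟨i⟩
  have hr : (0 : ℝ) < r := Nat.cast_pos.2 hQ.r_pos
  have hk : (0 : ℝ) < k := Nat.cast_pos.2 hQ.isDesign.one_le_k
  have hb : (0 : ℝ) < b := hQ.card_blocks ▸ Nat.cast_pos.2 Fintype.card_pos
  have he := hG.degree_eq hd
  have hrowM : r * e₀ = (θ₁ + θ₂) * r + s * b := by
    have h1 := congrArg (· * allOnes B B ℝ) hMA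
    simp only [Matrix.mul_assoc, hd.adjMatrix_mul_allOnes, Matrix.add_mul, Matrix.smul_mul,
      Matrix.mul_smul, hQ.incidenceMatrix_mul_allOnes, allOnes_mul_allOnes, hQ.card_blocks, he,
      smul_smul, ← add_smul] at h1
    linarith [smul_allOnes_inj h1]
  have hcolM : k * e₀ = (θ₁ + θ₂) * k + s * v := by
    have h1 := congrArg (allOnes P P ℝ * ·) hMA
    simp only [← Matrix.mul_assoc, hd.allOnes_mul_adjMatrix, Matrix.mul_add, Matrix.smul_mul,
      Matrix.mul_smul, hQ.isDesign.allOnes_mul_incidenceMatrix, allOnes_mul_allOnes,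
      hQ.isDesign.card_points, he, smul_smul, ← add_smul] at h1
    linarith [smul_allOnes_inj h1]
  have hrowP : (r * k : ℝ) = r - lam + lam * v := by
    have h1 := congrArg (· * allOnes P P ℝ) (hQ.incidenceMatrix_mul_transpose ℝ)
    simp only [Matrix.mul_assoc, hQ.isDesign.transpose_incidenceMatrix_mul_allOnes,
      Matrix.add_mul, Matrix.smul_mul, Matrix.mul_smul, hQ.incidenceMatrix_mul_allOnes,
      Matrix.one_mul, allOnes_mul_allOnes, hQ.isDesign.card_points, smul_smul, ← add_smul] at h1
    linarith [smul_allOnes_inj h1]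
  have hrowB : r * k + e₀ * e₀ =
      (k + e₀ + θ₁ * θ₂) * b + (θ₁ + θ₂) * e₀ - θ₁ * θ₂ := by
    have h1 := congrArg (· * allOnes B B ℝ) hBB
    simp only [Matrix.mul_assoc, hQ.isDesign.transpose_incidenceMatrix_mul_allOnes,
      hd.adjMatrix_mul_allOnes, Matrix.add_mul, Matrix.sub_mul, Matrix.smul_mul, Matrix.mul_smul,
      hQ.incidenceMatrix_mul_allOnes, Matrix.one_mul, allOnes_mul_allOnes, hQ.card_blocks, he,
      smul_smul, ← add_smul, ← sub_smul] at h1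
    linarith [smul_allOnes_inj h1]
  have hv : (0 : ℝ) < v := hQ.isDesign.card_points ▸ Nat.cast_pos.2 Fintype.card_pos
  have hlv : (lam * v : ℝ) = r * k + θ₁ * θ₂ := by linarith
  have hlv0 : (0 : ℝ) < lam * v := mul_pos hlam0 hv
  have hlt : θ₁ + θ₂ < e₀ := by
    have : (0 : ℝ) < (e₀ - (θ₁ + θ₂)) * r := by linarith [mul_pos hs0 hb]
    linarith [pos_of_mul_pos_left this hr.le]
  -- The quotient of N has rows (λv, sb) and (sv, mb) with m = k + e₀ + θ₁θ₂, so its determinant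
  -- vanishes; this determinant is p(θ₁)p(θ₂).
  have hdet : (θ₁ * θ₁ - e₀ * θ₁ - r * k) * (θ₂ * θ₂ - e₀ * θ₂ - r * k) = 0 := by
    have h1 : (s * v) * (s * b) = (lam * v) * ((k + e₀ + θ₁ * θ₂) * b) := by
      linear_combination v * b * hss
    have h2 : (k + e₀ + θ₁ * θ₂) * b = r * k + e₀ * e₀ - (θ₁ + θ₂) * e₀ + θ₁ * θ₂ := by linarith
    have h3 : s * b = r * (e₀ - θ₁ - θ₂) := by linarith
    have h4 : s * v = k * (e₀ - θ₁ - θ₂) := by linarith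
    rw [h2, h3, h4, hlv] at h1
    linear_combination -h1
  -- p(θ₁) = 0 would give θ₁(θ₁ + θ₂ − e₀) = λv > 0, against e₀ > θ₁ + θ₂. So θ₂ is a root of p, the
  -- other root is e₀ − θ₂, and θ₀ > 0 > θ₂.
  rcases mul_eq_zero.1 hdet with h1 | h1
  · have : 0 < θ₁ * (θ₁ + θ₂ - e₀) := by linarith
    linarith [pos_of_mul_pos_right this hθ₁.le]
  · have h2 : (θ₀ - θ₂) * (θ₀ - (e₀ - θ₂)) = 0 := by linear_combination hprod - h1
    rcases mul_eq_zero.1 h2 with h3 | h3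
    · linarith
    · rw [← sub_eq_zero.1 h3]
      exact h

theorem IsQSD.isG3_wholeGraph (hQ : IsQSD blk v k lam b r x y) {θ₁ θ₂ e₀ e₁ e₂ : ℝ}
    (hθ₁ : 0 < θ₁) (hθ₂ : θ₂ < 0) (hG : IsG3 (blockGraph blk x) e₀ e₁ e₂)
    (hx : (x : ℝ) = k + (θ₁ + 1) * (θ₂ + 1) - (e₁ + 1) * (e₂ + 1))
    (hy : (y : ℝ) = k + θ₁ * θ₂ - e₁ * e₂)
    (hlam : (lam : ℝ) = r + (θ₁ + 1) * (θ₂ + 1))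
    (hsum : ((r : ℝ) - lam + y - k) / (x - y) = θ₁ + θ₂ + 1)
    (hs : (k : ℝ) + (lam * k - y * r) / (x - y) =
      √(((v : ℝ) - 1 + r + θ₁ * θ₂) * (k + e₀ + θ₁ * θ₂))) :
    IsG3 (wholeGraph blk x)
      (((v : ℝ) - 1 + e₀ + √(((v : ℝ) - 1 - e₀) ^ 2 + 4 * r * k)) / 2) θ₁ θ₂ := by
  obtain ⟨hm, hBB⟩ := hQ.block_quadratic_relation hG hx hy
  have hMA := hQ.incidenceMatrix_mul_adjMatrix ℝ
  -- In MA the matrix J now has coefficient s − k and M has θ₁ + θ₂ + 1; adding (J − I)M = kJ − M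
  -- corrects both.
  rw [hsum, ← sub_eq_iff_eq_add'.2 hs.symm] at hMA
  have hr : (0 : ℝ) < r := Nat.cast_pos.2 hQ.r_pos
  have hk : (0 : ℝ) < k := Nat.cast_pos.2 hQ.isDesign.one_le_k
  have hv : (1 : ℝ) ≤ v := Nat.one_le_cast.2 (hQ.isDesign.one_le_k.trans hQ.isDesign.k_le_v)
  obtain ⟨θ₀, hs0, -, hθ₀, hprod, h⟩ := hQ.isG3_pointBlockGraph ⊤ (d := v - 1)
    (l := v - 1 + r + θ₁ * θ₂) hG 
    (by
      rw [SimpleGraph.adjMatrix_of_eq_top (G := ⊤) rfl, Matrix.sub_mul, allOnes_mul_allOnes,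
        hQ.isDesign.card_points, Matrix.one_mul]
      module)
    (by
      rw [SimpleGraph.adjMatrix_of_eq_top (G := ⊤) rfl, Matrix.sub_mul, allOnes_mul_allOnes,
        hQ.isDesign.card_points, Matrix.one_mul]
      module)
    (by linarith) hm rfl (hθ₂.trans hθ₁) hθ₂
    (by
      rw [SimpleGraph.adjMatrix_of_eq_top (G := ⊤) rfl, hQ.incidenceMatrix_mul_transpose,
        hlam, sub_mul, mul_sub, allOnes_mul_allOnes, hQ.isDesign.card_points, mul_one, one_mul]
      module)
    (by
      rw [SimpleGraph.adjMatrix_of_eq_top (G := ⊤) rfl, hMA, Matrix.sub_mul, Matrix.one_mul,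
        hQ.isDesign.allOnes_mul_incidenceMatrix]
      module)
    hBB
  -- As θ₀ exceeds both v − 1 and e₀, it is the larger root of the quadratic.
  have hge : 0 < θ₀ - e₀ := by
    have h1 : 0 < (θ₀ - (v - 1)) * (θ₀ - e₀) := hprod ▸ mul_pos hr hk
    exact pos_of_mul_pos_right h1 (by linarith)
  have hsq : √(((v : ℝ) - 1 - e₀) ^ 2 + 4 * r * k) = 2 * θ₀ - (v - 1 + e₀) := by
    rw [Real.sqrt_eq_iff_mul_self_eq_of_pos (by linarith)]
    linear_combination 4 * hprod
  have hval : ((v : ℝ) - 1 + e₀ + √(((v : ℝ) - 1 - e₀) ^ 2 + 4 * r * k)) / 2 = θ₀ := by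
    rw [hsq]
    ring
  rw [hval]
  exact h

theorem IsQSD.coherentRank_totalGraph (hQ : IsQSD blk v k lam b r x y) {e₀ e₁ e₂ : ℝ}
    (hG : IsG3 (blockGraph blk x) e₀ e₁ e₂) (hne : (r : ℝ) ≠ k + e₀) :
    coherentRank (totalGraph blk x) = 9 := by
  obtain ⟨d, hd⟩ := hQ.exists_isRegularOfDegree
  refine hQ.coherentRank_pointBlockGraph ⊥ (d := 0) (fun p => by simp) hd ?_
    (hG.adjMatrix_mul_self_mem_span hd) ?_
  · rw [SimpleGraph.adjMatrix_of_eq_bot (G := ⊥) rfl]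
    exact zero_mem _
  · rw [← hG.degree_eq hd] at hne
    rw [zero_add]
    exact_mod_cast hne

theorem IsQSD.coherentRank_wholeGraph (hQ : IsQSD blk v k lam b r x y) {e₀ e₁ e₂ : ℝ}
    (hG : IsG3 (blockGraph blk x) e₀ e₁ e₂) (hne : (v : ℝ) - 1 + r ≠ k + e₀) :
    coherentRank (wholeGraph blk x) = 9 := by
  obtain ⟨d, hd⟩ := hQ.exists_isRegularOfDegree
  refine hQ.coherentRank_pointBlockGraph ⊤ (d := v - 1)
    (fun p => by simp [← hQ.isDesign.card_points]) hd ?_ (hG.adjMatrix_mul_self_mem_span hd) ?_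
  · rw [SimpleGraph.adjMatrix_of_eq_top (G := ⊤) rfl]
    exact sub_mem (Submodule.subset_span (by simp)) (Submodule.subset_span (by simp))
  · rw [← hG.degree_eq hd] at hne
    -- The valency v − 1 is a truncated difference; v ≥ k ≥ 1 makes it agree with the real one.
    rw [← Nat.cast_pred (hQ.isDesign.one_le_k.trans hQ.isDesign.k_le_v)] at hne
    exact_mod_cast hne

end Main

end ThreeEigenvalues

theorem theorem5p8 {P B : Type*} [Fintype P] [Fintype B] (blk : B → Finset P)
    (v k lam b r x y : ℕ) (hQ : IsQSD blk v k lam b r x y)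
    (θ₁ θ₂ : ℤ) (hθ₁ : 1 ≤ θ₁) (hθ₂ : θ₂ ≤ -2)
    (e₀ e₁ e₂ : ℝ) (hB : IsG3 (blockGraph blk x) e₀ e₁ e₂)
    (hx : (x : ℝ) = k + (θ₁ + 1) * (θ₂ + 1) - (e₁ + 1) * (e₂ + 1))
    (hy : (y : ℝ) = k + θ₁ * θ₂ - e₁ * e₂) :
    (((lam : ℝ) = r + θ₁ * θ₂ →
      ((r : ℝ) - lam + y - k) / (x - y) = θ₁ + θ₂ →
      ((lam : ℝ) * k - y * r) / (x - y) = Real.sqrt (lam * (k + e₀ + θ₁ * θ₂)) →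
        IsG3 (totalGraph blk x) (e₀ - θ₂) θ₁ θ₂ ∧
        ((r : ℝ) ≠ k + e₀ → coherentRank (totalGraph blk x) = 9))) ∧
    (((lam : ℝ) = r + (θ₁ + 1) * (θ₂ + 1) →
      ((r : ℝ) - lam + y - k) / (x - y) = θ₁ + θ₂ + 1 →
      (k : ℝ) + (lam * k - y * r) / (x - y) =
        Real.sqrt (((v : ℝ) - 1 + r + θ₁ * θ₂) * (k + e₀ + θ₁ * θ₂)) →
        IsG3 (wholeGraph blk x)
          (((v : ℝ) - 1 + e₀ + Real.sqrt (((v : ℝ) - 1 - e₀) ^ 2 + 4 * r * k)) / 2) θ₁ θ₂ ∧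
        ((v : ℝ) - 1 + r ≠ k + e₀ → coherentRank (wholeGraph blk x) = 9))) := by
  have h₁ : (0 : ℝ) < θ₁ := Int.cast_pos.2 (by lia)
  have h₂ : (θ₂ : ℝ) < 0 := Int.cast_lt_zero.2 (by lia)
  exact ⟨fun hlam hsum hs => ⟨hQ.isG3_totalGraph h₁ h₂ hB hx hy hlam hsum hs,
      hQ.coherentRank_totalGraph hB⟩,
    fun hlam hsum hs => ⟨hQ.isG3_wholeGraph h₁ h₂ hB hx hy hlam hsum hs,
      hQ.coherentRank_wholeGraph hB⟩⟩
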